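/- Let $d\ge 1$. For $x,y\in\mathbb Z^d$ let $\|x-y\|$ be the $\ell^1$ (graph) distance, and write $x\sim y$ if $\|x-y\|=1$. Let $\Gamma\subset\mathbb Z^d$, let $V_0:\mathbb Z^d\to\mathbb R$, and suppose that $\Gamma$ and $V_0$ are invariant under translations by a subgroup of finite index of $\mathbb Z^d$. Let $\mu$ be a probability measure on $\mathbb R$ such that (i) for some $\alpha>0$ and $C<\infty$ one has $\mu[t-\epsilon,t+\epsilon]\le C\epsilon^\alpha$ for all $\epsilon>0$ and $t\in\mathbb R$; (ii) $\int |t|^q\,d\mu(t)<\infty$ for some $q>0$. Let $V$ be a random potential on $\mathbb Z^d$ such that $V(x)=0$ for $x\notin\Gamma$ and the variables $V(x)$, $x\in\Gamma$, are independent with distribution $\mu$. For $g\ge 0$ let $H(g)=-\Delta+V_0+gV$ be the (in general unbounded) operator $$[H(g)\psi](x)=\sum_{y\sim x}(\psi(x)-\psi(y))+(V_0(x)+gV(x))\psi(x)$$ on $\ell^2(\mathbb Z^d)$ with its maximal domain $\{\psi\in\ell^2(\mathbb Z^d): H(g)\psi\in\ell^2(\mathbb Z^d)\}$, and let $G_z[H(g)](x,y)=\langle\delta_x,(H(g)-z)^{-1}\delta_y\rangle$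 for $z\in\mathbb C\setminus\mathbb R$. **Theorem.** Suppose that all connected components $B_j$ of $\Gamma^c=\mathbb Z^d\setminus\Gamma$ (in the nearest-neighbour graph) are finite, and that $\operatorname{dist}(B_i,B_j)\ge 3$ for $i\ne j$. Then there exist $0<s<1$, $\eta>0$ and $g_0>0$ such that for all $g\ge g_0$ and all $\lambda\in\mathbb R$ $$\sup_{\epsilon>0}\ \sup_{x\in\mathbb Z^d}\ \sum_{y\in\mathbb Z^d}\mathbb E\,|G_{\lambda+i\epsilon}[H(g)](x,y)|^s\,e^{\eta\|x-y\|}<\infty .$$ -/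

import Mathlib

open MeasureTheory ProbabilityTheory
open scoped ENNReal

/-- The sites of the lattice `ℤ^d`. -/
abbrev Site (d : ℕ) : Type := Fin d → ℤ

/-- The `ℓ¹` distance on `ℤ^d`, which is the graph distance. -/
def l1dist {d : ℕ} (x y : Site d) : ℕ := ∑ i, (x i - y i).natAbs

/-- The nearest-neighbour graph of `ℤ^d`. -/
def latticeGraph (d : ℕ) : SimpleGraph (Site d) where
  Adj x y := l1dist x y = 1
  symm := ⟨fun x y h => by
    have : l1dist y x = l1dist x y :=
      Finset.sum_congr rfl fun i _ => by omega
    rw [this]; exact h⟩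
  loopless := ⟨fun x h => by simp [l1dist] at h⟩

/-- The unit vector `e_i`; the neighbours of `x` in `ℤ^d` are the `2d` sites `x ± e_i`. -/
def unitVec {d : ℕ} (i : Fin d) : Site d := Pi.single i 1

/-- The Hilbert space `ℓ²(ℤ^d)`. -/
abbrev EllTwo (d : ℕ) : Type := lp (fun _ : Site d => ℂ) 2

/-- The formal Schrödinger operator `-Δ + U` on all functions `ℤ^d → ℂ`:
`ψ ↦ (x ↦ ∑_{y ∼ x} (ψ x - ψ y) + U x ψ x)`. -/
def schrodingerMap {d : ℕ} (U : Site d → ℝ) :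
    (Site d → ℂ) →ₗ[ℂ] (Site d → ℂ) where
  toFun ψ x :=
    (∑ i : Fin d, ((ψ x - ψ (x + unitVec i)) + (ψ x - ψ (x - unitVec i)))) + (U x : ℂ) * ψ x
  map_add' ψ χ := by
    funext x
    simp only [Pi.add_apply, mul_add]
    rw [add_add_add_comm, ← Finset.sum_add_distrib]
    congr 1
    exact Finset.sum_congr rfl fun i _ => by ring
  map_smul' c ψ := by
    funext x
    simp only [Pi.smul_apply, smul_eq_mul, RingHom.id_apply, mul_add, Finset.mul_sum]
    congr 1
    · exact Finset.sum_congr rfl fun i _ => by ring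
    · ring

/-- The Schrödinger operator `-Δ + U` as an (in general unbounded) operator on `ℓ²(ℤ^d)`, on its
maximal domain `{ψ ∈ ℓ² | (-Δ + U) ψ ∈ ℓ²}`. -/
def schrodinger {d : ℕ} (U : Site d → ℝ) : EllTwo d →ₗ.[ℂ] EllTwo d where
  domain :=
    { carrier := {ψ | Memℓp (schrodingerMap U (ψ : Site d → ℂ)) 2}
      add_mem' := fun {ψ χ} hψ hχ => by
        have h := Memℓp.add hψ hχ
        rwa [← map_add] at h
      zero_mem' := by
        have h : schrodingerMap U ((0 : EllTwo d) : Site d → ℂ) = 0 := map_zero _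
        simp only [Set.mem_ofPred_eq, h]
        exact zero_memℓp
      smul_mem' := fun c ψ hψ => by
        have h := Memℓp.const_smul hψ c
        rwa [← map_smul] at h }
  toFun :=
    { toFun := fun ψ => ⟨schrodingerMap U ((ψ : EllTwo d) : Site d → ℂ), ψ.2⟩
      map_add' := fun ψ χ => by
        apply lp.ext
        exact map_add (schrodingerMap U) _ _
      map_smul' := fun c ψ => by
        apply lp.ext
        exact map_smul (schrodingerMap U) _ _ }

lemma schrodinger_apply {d : ℕ} (U : Site d → ℝ) (ψ : (schrodinger U).domain) (x : Site d) :
    schrodinger U ψ x = schrodingerMap U ((ψ : EllTwo d) : Site d → ℂ) x := rfl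

lemma summable_conj_mul_shift {d : ℕ} (ψ : EllTwo d) (a : Site d) :
    Summable fun x : Site d => starRingEnd ℂ (ψ x) * ψ (x + a) := by
  have h1 : Summable fun x : Site d => ‖ψ x‖ ^ 2 := by
    simpa using (lp.memℓp ψ).summable (by norm_num)
  have h2 : Summable fun x : Site d => ‖ψ (x + a)‖ ^ 2 :=
    h1.comp_injective (add_left_injective a)
  refine Summable.of_norm_bounded (h1.add h2) fun x => ?_
  rw [norm_mul, RCLike.norm_conj]
  nlinarith [sq_nonneg (‖ψ x‖ - ‖ψ (x + a)‖), sq_nonneg (‖ψ x‖ + ‖ψ (x + a)‖)]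

lemma tsum_im_shift {d : ℕ} (ψ : EllTwo d) (a : Site d) :
    HasSum (fun x : Site d => (starRingEnd ℂ (ψ x) * ψ (x + a)
      + starRingEnd ℂ (ψ x) * ψ (x - a)).im) 0 := by
  have h1 := (summable_conj_mul_shift ψ a).hasSum
  have h2 := (summable_conj_mul_shift ψ (-a)).hasSum
  have h3 : ∑' x : Site d, starRingEnd ℂ (ψ x) * ψ (x + -a)
      = starRingEnd ℂ (∑' x : Site d, starRingEnd ℂ (ψ x) * ψ (x + a)) := by
    rw [Complex.conj_tsum, ← (Equiv.addRight a).tsum_eq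
      (fun x : Site d => starRingEnd ℂ (ψ x) * ψ (x + -a))]
    refine tsum_congr fun x => ?_
    simp [mul_comm]
  rw [h3] at h2
  have h4 := Complex.hasSum_im (h1.add h2)
  simpa [sub_eq_add_neg] using h4

/-- The quadratic form of `-Δ + U` is real. -/
lemma schrodinger_inner_im {d : ℕ} (U : Site d → ℝ) (ψ : (schrodinger U).domain) :
    (inner ℂ (ψ : EllTwo d) (schrodinger U ψ)).im = 0 := by
  have h1 := Complex.hasSum_im (lp.hasSum_inner (ψ : EllTwo d) (schrodinger U ψ))
  have h2 : HasSum (fun x : Site d => -∑ i : Fin d,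
      (starRingEnd ℂ ((ψ : EllTwo d) x) * (ψ : EllTwo d) (x + unitVec i)
      + starRingEnd ℂ ((ψ : EllTwo d) x) * (ψ : EllTwo d) (x - unitVec i)).im) 0 := by
    simpa using (hasSum_sum (s := Finset.univ) fun i _ =>
      tsum_im_shift (ψ : EllTwo d) (unitVec (d := d) i)).neg
  refine h1.unique ?_
  convert h2 using 2 with x
  rw [schrodinger_apply]
  simp only [schrodingerMap, LinearMap.coe_mk, AddHom.coe_mk, RCLike.inner_apply, add_mul,
    Finset.sum_mul, Complex.add_im, Complex.im_sum]
  rw [← Finset.sum_neg_distrib]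
  simp only [Complex.mul_im, Complex.mul_re, Complex.conj_re, Complex.conj_im, Complex.sub_im,
    Complex.sub_re, Complex.ofReal_re, Complex.ofReal_im]
  rw [show ∀ a b c : ℝ, a + b = c ↔ a = c - b from fun a b c => by constructor <;> intro h <;> linarith]
  ring_nf
  refine Finset.sum_congr rfl fun i _ => ?_
  ring

lemma schrodinger_lower_bound {d : ℕ} (U : Site d → ℝ) (z : ℂ) (ψ : (schrodinger U).domain) :
    |z.im| * ‖(ψ : EllTwo d)‖ ≤ ‖schrodinger U ψ - z • (ψ : EllTwo d)‖ := by
  by_cases h0 : ‖(ψ : EllTwo d)‖ = 0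
  · rw [h0, mul_zero]; exact norm_nonneg _
  have h1 : (inner ℂ (ψ : EllTwo d) (schrodinger U ψ - z • (ψ : EllTwo d))).im
      = -(z.im * ‖(ψ : EllTwo d)‖ ^ 2) := by
    rw [inner_sub_right, inner_smul_right, Complex.sub_im, schrodinger_inner_im,
      inner_self_eq_norm_sq_to_K, Complex.mul_im]
    simp [← Complex.ofReal_pow]
  have h2 := (Complex.abs_im_le_norm _).trans
    (norm_inner_le_norm (𝕜 := ℂ) (ψ : EllTwo d) (schrodinger U ψ - z • (ψ : EllTwo d)))
  rw [h1, abs_neg, abs_mul, abs_of_nonneg (sq_nonneg ‖(ψ : EllTwo d)‖)] at h2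
  have h3 : 0 < ‖(ψ : EllTwo d)‖ := lt_of_le_of_ne (norm_nonneg _) (Ne.symm h0)
  refine le_of_mul_le_mul_left ?_ h3
  linarith [h2, pow_two ‖(ψ : EllTwo d)‖,
    show ‖(ψ : EllTwo d)‖ * (|z.im| * ‖(ψ : EllTwo d)‖) = |z.im| * ‖(ψ : EllTwo d)‖ ^ 2 by ring]

lemma single_mem_domain {d : ℕ} (U : Site d → ℝ) (x : Site d) :
    lp.single 2 x (1 : ℂ) ∈ (schrodinger U).domain := by
  change Memℓp (schrodingerMap U ((lp.single 2 x (1 : ℂ) : EllTwo d) : Site d → ℂ)) 2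
  refine (memℓp_zero (Set.Finite.subset (s := {x} ∪ ⋃ i : Fin d, {x - unitVec i, x + unitVec i})
    ?_ ?_)).of_exponent_ge zero_le
  · exact (Set.finite_singleton x).union (Set.finite_iUnion fun i => by simp)
  · intro y hy
    by_contra hn
    simp only [Set.mem_union, Set.mem_singleton_iff, Set.mem_iUnion, Set.mem_insert_iff,
      not_or, not_exists] at hn
    apply hy
    have h1 : ∀ i : Fin d, y + unitVec i ≠ x := fun i h => (hn.2 i).1 (by rw [← h]; abel)
    have h2 : ∀ i : Fin d, y - unitVec i ≠ x := fun i h => (hn.2 i).2 (by rw [← h]; abel)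
    simp [schrodingerMap, hn.1, h1, h2]

/-- For non-real `z` the equation `(-Δ + U - z) ψ = φ` has exactly one solution in the domain. -/
theorem schrodinger_existsUnique {d : ℕ} (U : Site d → ℝ) {z : ℂ} (hz : z.im ≠ 0)
    (φ : EllTwo d) :
    ∃! ψ : (schrodinger U).domain, schrodinger U ψ - z • (ψ : EllTwo d) = φ := by
  let T : (schrodinger U).domain →ₗ[ℂ] EllTwo d :=
    (schrodinger U).toFun - z • (schrodinger U).domain.subtype
  have hT : ∀ ψ, T ψ = schrodinger U ψ - z • (ψ : EllTwo d) := fun ψ => rfl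
  have hz' : 0 < |z.im| := abs_pos.2 hz
  have hclosed : IsClosed (LinearMap.range T : Set (EllTwo d)) := by
    refine isClosed_of_closure_subset fun χ hχ => ?_
    obtain ⟨u, hu, hlim⟩ := mem_closure_iff_seq_limit.1 hχ
    choose ψ hψ using hu
    have hcau : CauchySeq fun n => (ψ n : EllTwo d) := by
      rw [Metric.cauchySeq_iff]
      intro ε hε
      obtain ⟨N, hN⟩ := Metric.cauchySeq_iff.1 hlim.cauchySeq (|z.im| * ε) (by positivity)
      refine ⟨N, fun m hm n hn => ?_⟩
      have h := hN m hm n hn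
      rw [dist_eq_norm, ← hψ m, ← hψ n, ← map_sub, hT] at h
      have h' := (schrodinger_lower_bound U z (ψ m - ψ n)).trans_lt h
      rw [dist_eq_norm]
      exact lt_of_mul_lt_mul_left h' hz'.le
    obtain ⟨ψ₀, hψ₀⟩ := cauchySeq_tendsto_of_complete hcau
    have hpt : ∀ {v : ℕ → EllTwo d} {w : EllTwo d}, Filter.Tendsto v Filter.atTop (nhds w) →
        ∀ x, Filter.Tendsto (fun n => v n x) Filter.atTop (nhds (w x)) := by
      intro v w hv x
      rw [tendsto_iff_norm_sub_tendsto_zero] at hv ⊢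
      exact squeeze_zero (fun _ => norm_nonneg _)
        (fun n => lp.norm_apply_le_norm two_ne_zero (v n - w) x) hv
    have heq : schrodingerMap U (ψ₀ : Site d → ℂ)
        = ((χ + z • ψ₀ : EllTwo d) : Site d → ℂ) := by
      funext x
      have h1 : Filter.Tendsto (fun n => schrodingerMap U ((ψ n : EllTwo d) : Site d → ℂ) x)
          Filter.atTop (nhds (schrodingerMap U (ψ₀ : Site d → ℂ) x)) := by
        simp only [schrodingerMap, LinearMap.coe_mk, AddHom.coe_mk]
        refine Filter.Tendsto.add (tendsto_finsetSum _ fun i _ => ?_)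
          ((hpt hψ₀ x).const_mul _)
        exact ((hpt hψ₀ x).sub (hpt hψ₀ _)).add ((hpt hψ₀ x).sub (hpt hψ₀ _))
      refine tendsto_nhds_unique h1 ?_
      have h2 := hpt (hlim.add (hψ₀.const_smul z)) x
      refine h2.congr fun n => ?_
      rw [← hψ n, hT, sub_add_cancel]
      rfl
    have hmem : ψ₀ ∈ (schrodinger U).domain := by
      change Memℓp _ 2
      rw [heq]
      exact lp.memℓp _
    refine ⟨⟨ψ₀, hmem⟩, ?_⟩
    rw [hT, sub_eq_iff_eq_add]
    apply lp.ext
    exact heq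
  have hdense : LinearMap.range T = ⊤ := by
    have : CompleteSpace (LinearMap.range T) := hclosed.completeSpace_coe
    rw [← Submodule.orthogonal_eq_bot_iff, Submodule.eq_bot_iff]
    intro χ hχ
    have heq : schrodingerMap U (χ : Site d → ℂ)
        = ((starRingEnd ℂ z • χ : EllTwo d) : Site d → ℂ) := by
      funext x
      have h := (Submodule.mem_orthogonal _ _).1 hχ _ ⟨⟨_, single_mem_domain U x⟩, rfl⟩
      rw [hT, inner_sub_left, inner_smul_left, lp.inner_single_left, lp.inner_eq_tsum] at h
      have h3 : ∑' y, inner ℂ (schrodinger U ⟨_, single_mem_domain U x⟩ y) (χ y)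
          = schrodingerMap U (χ : Site d → ℂ) x := by
        have hs : ∀ a : Site d, HasSum
            (fun y : Site d => (Pi.single x (1 : ℂ) : Site d → ℂ) (y + a) * χ y)
            (χ (x - a)) := by
          intro a
          have := hasSum_single (f := fun y : Site d =>
            (Pi.single x (1 : ℂ) : Site d → ℂ) (y + a) * χ y) (x - a) (fun y hy => by
              have : y + a ≠ x := fun h => hy (by rw [← h]; abel)
              simp [this])
          simpa using this
        have h0 : HasSum (fun y : Site d => (Pi.single x (1 : ℂ) : Site d → ℂ) y * χ y)
            (χ x) := by simpa using hs 0
        have hU : HasSum (fun y : Site d =>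
            (U y : ℂ) * ((Pi.single x (1 : ℂ) : Site d → ℂ) y * χ y)) ((U x : ℂ) * χ x) := by
          have := hasSum_single (f := fun y : Site d =>
            (U y : ℂ) * ((Pi.single x (1 : ℂ) : Site d → ℂ) y * χ y)) x (fun y hy => by
              simp [hy])
          simpa using this
        have hall := (hasSum_sum (s := Finset.univ) fun (i : Fin d) _ =>
          (h0.sub (hs (unitVec i))).add (h0.sub (hs (-unitVec i)))).add hU
        have h4 : (fun y => inner ℂ (schrodinger U ⟨_, single_mem_domain U x⟩ y) (χ y)) =
            fun y => (∑ i : Fin d,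
              (((Pi.single x (1 : ℂ) : Site d → ℂ) y * χ y
                - (Pi.single x (1 : ℂ) : Site d → ℂ) (y + unitVec i) * χ y)
              + ((Pi.single x (1 : ℂ) : Site d → ℂ) y * χ y
                - (Pi.single x (1 : ℂ) : Site d → ℂ) (y + -unitVec i) * χ y)))
              + (U y : ℂ) * ((Pi.single x (1 : ℂ) : Site d → ℂ) y * χ y) := by
          funext y
          have hc : ∀ w : Site d, starRingEnd ℂ ((Pi.single x (1 : ℂ) : Site d → ℂ) w)
              = (Pi.single x (1 : ℂ) : Site d → ℂ) w := fun w => by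
            by_cases h : w = x
            · subst h; simp
            · simp [h]
          rw [schrodinger_apply, RCLike.inner_apply]
          simp only [schrodingerMap, LinearMap.coe_mk, AddHom.coe_mk, lp.coeFn_single, map_add,
            map_sum, map_mul, map_sub, Complex.conj_ofReal, hc, mul_add, Finset.mul_sum,
            ← sub_eq_add_neg]
          congr 1
          · exact Finset.sum_congr rfl fun i _ => by ring
          · ring
        rw [h4, hall.tsum_eq]
        simp only [schrodingerMap, LinearMap.coe_mk, AddHom.coe_mk, sub_neg_eq_add]
        congr 1
        exact Finset.sum_congr rfl fun i _ => by ring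
      rw [h3, sub_eq_zero] at h
      rw [h]
      simp
    have hmem : χ ∈ (schrodinger U).domain := by
      change Memℓp _ 2
      rw [heq]
      exact lp.memℓp _
    have h5 : schrodinger U ⟨χ, hmem⟩ - starRingEnd ℂ z • χ = 0 := by
      rw [sub_eq_zero]
      apply lp.ext
      exact heq
    have h6 := schrodinger_lower_bound U (starRingEnd ℂ z) ⟨χ, hmem⟩
    rw [h5, norm_zero, Complex.conj_im, abs_neg] at h6
    have h7 : ‖χ‖ ≤ 0 := by
      by_contra hc
      push Not at hc
      have := mul_pos hz' hc
      exact absurd h6 (not_le.2 this)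
    exact norm_le_zero_iff.1 h7
  obtain ⟨ψ, hψ⟩ := LinearMap.range_eq_top.1 hdense φ
  refine ⟨ψ, hψ, fun ψ' hψ' => ?_⟩
  have h8 : schrodinger U (ψ' - ψ) - z • ((ψ' - ψ : (schrodinger U).domain) : EllTwo d) = 0 := by
    rw [← hT, map_sub, hψ, hT]
    exact sub_eq_zero.2 hψ'
  have h9 := schrodinger_lower_bound U z (ψ' - ψ)
  rw [h8, norm_zero] at h9
  have h10 : ‖((ψ' - ψ : (schrodinger U).domain) : EllTwo d)‖ ≤ 0 := by
    by_contra hc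
    push Not at hc
    exact absurd h9 (not_le.2 (mul_pos hz' hc))
  exact sub_eq_zero.1 (Subtype.ext (norm_le_zero_iff.1 h10))

open Classical in
/-- The resolvent `G_z = (-Δ + U - z)⁻¹`, as a map on `ℓ²(ℤ^d)`: it sends `φ` to the unique `ψ` in
the domain with `(-Δ + U - z) ψ = φ`, which exists for every non-real `z`
(for other `z`, if there is no such unique `ψ`, the value is `0`; this is not used). -/
noncomputable def resolventMap {d : ℕ} (U : Site d → ℝ) (z : ℂ) (φ : EllTwo d) : EllTwo d :=
  if h : ∃! ψ : (schrodinger U).domain, schrodinger U ψ - z • (ψ : EllTwo d) = φ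
  then (h.choose : EllTwo d) else 0

/-- The Green function `G_z(x, y) = ⟨δ_x, (-Δ + U - z)⁻¹ δ_y⟩`. -/
noncomputable def green {d : ℕ} (U : Site d → ℝ) (z : ℂ) (x y : Site d) : ℂ :=
  inner ℂ (lp.single 2 x (1 : ℂ) : EllTwo d) (resolventMap U z (lp.single 2 y (1 : ℂ)))

/-- The potential `V₀ + g V` of `H(g) = -Δ + V₀ + g V`. -/
def trimmedPotential {Ω : Type*} {d : ℕ} (V₀ : Site d → ℝ) (V : Ω → Site d → ℝ) (g : ℝ)
    (ω : Ω) (x : Site d) : ℝ :=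
  V₀ x + g * V ω x

/-- The random potential vanishes off `Γ`, and its values on `Γ` are independent with common
distribution `μ`. -/
structure IsTrimmedRandomPotential {Ω : Type*} [MeasurableSpace Ω] (P : Measure Ω) {d : ℕ}
    (Γ : Set (Site d)) (μ : Measure ℝ) (V : Ω → Site d → ℝ) : Prop where
  eq_zero : ∀ ω, ∀ x ∉ Γ, V ω x = 0
  measurable : ∀ x ∈ Γ, Measurable fun ω => V ω x
  law : ∀ x ∈ Γ, P.map (fun ω => V ω x) = μ
  indep : iIndepFun (fun (x : Γ) ω => V ω x) P

/-- `Γ` and `V₀` are invariant under a subgroup of `ℤ^d` of finite index. -/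
def IsCofinitelyInvariant {d : ℕ} (Γ : Set (Site d)) (V₀ : Site d → ℝ) : Prop :=
  ∃ 𝒢 : AddSubgroup (Site d), 𝒢.FiniteIndex ∧
    ∀ a ∈ 𝒢, ∀ x, (x + a ∈ Γ ↔ x ∈ Γ) ∧ V₀ (x + a) = V₀ x

/-- `μ` is `α`-regular for some `α > 0`. -/
def IsAlphaRegular (μ : Measure ℝ) : Prop :=
  ∃ α : ℝ, 0 < α ∧ ∃ C : ℝ, ∀ ε : ℝ, 0 < ε → ∀ t : ℝ,
    μ (Set.Icc (t - ε) (t + ε)) ≤ ENNReal.ofReal (C * ε ^ α)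

/-- `μ` has a finite `q`-moment for some `q > 0`. -/
def HasFiniteMoment (μ : Measure ℝ) : Prop :=
  ∃ q : ℝ, 0 < q ∧ Integrable (fun t : ℝ => |t| ^ q) μ

/-- The complement of `Γ` is a union of finite connected components, any two of which are
at distance at least `3` from each other. -/
def IsDoublyInsulated {d : ℕ} (Γ : Set (Site d)) : Prop :=
  (∀ B : ((latticeGraph d).induce Γᶜ).ConnectedComponent, B.supp.Finite) ∧
    ∀ B B' : ((latticeGraph d).induce Γᶜ).ConnectedComponent, B ≠ B' →
      ∀ x ∈ B.supp, ∀ y ∈ B'.supp, 3 ≤ l1dist (x : Site d) (y : Site d)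

/-- The fractional moment bound at energy `lam` for `H = -Δ + U`, with exponents `s` and `η`:
`sup_{ε > 0} sup_x ∑_y 𝔼 |G_{lam + iε}[H](x, y)|^s e^{η ‖x - y‖} < ∞`. -/
def FractionalMomentBound {Ω : Type*} [MeasurableSpace Ω] (P : Measure Ω) {d : ℕ}
    (U : Ω → Site d → ℝ) (s η lam : ℝ) : Prop :=
  (⨆ (ε : ℝ) (_ : 0 < ε) (x : Site d), ∑' y : Site d,
    (∫⁻ ω, ENNReal.ofReal (‖green (U ω) (lam + ε * Complex.I) x y‖ ^ s) ∂P) *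
      ENNReal.ofReal (Real.exp (η * l1dist x y))) < ∞

/-!
The proof is the fractional moment method at strong disorder, run with clusters instead of sites,
and completed by a unique continuation argument inside the components of `Γᶜ`.

Everything is done for the Green functions `boxGreen` of finite boxes, uniformly in the box; since
these converge to the Green function of the whole lattice (`tendsto_boxGreen`), Fatou's lemma
transfers the bounds to infinite volume.

*A priori bound.* As a function of the two potentials at distinct sites `x, u ∈ Γ` alone, the Green
function between `x` and `u` is an entry of the inverse of a two by two matrix, namely `diag (U x, U u)`
minus a fixed symmetric matrix. The regularity of `μ` then gives `𝔼 |G(x, u)|^s ≤ C g^{-s}`,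
conditionally on the potential at all other sites and uniformly in `z`
(`lmarginal_boxGreen_le`).

*Decay on `Γ`.* Double insulation allows `ℤ^d` to be partitioned into clusters of bounded diameter
(a component of `Γᶜ` with its boundary, or a single site of `Γ`) such that bonds between different
clusters join sites of `Γ`. By the geometric resolvent identity, the Green function from `x` to a
different cluster is a sum of products of a Green function inside the cluster of `x` and a Green
function of the box depleted of this cluster. The second factor does not depend on the potential in
the cluster, so the a priori bound applies to the first one. Iterating, every cluster that has to be
crossed costs a factor `C g^{-s}`, which beats the bounded number of ways to leave a cluster if `g`
is large (`lmarginal_boxGreen_le_half_pow`).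

*Decay off `Γ`.* At an energy which is an eigenvalue of the restriction of the operator to a
component of `Γᶜ` there is no a priori bound inside this component. However, the equation at
`x + e₁` expresses `G(x, y)` through the Green function at sites with larger first coordinate. After
a bounded number of such steps only sites of `Γ` are involved. The coefficients contain the random
potential, and the Cauchy–Schwarz inequality together with the moment assumption on `μ` shows that
each step costs a factor two in the exponent `s` and in the rate of decay (`HasBoxDecay.propagate`).
The symmetry of the Green function allows the same to be done in `y`.

The coefficients of the last argument grow with `z`, so it is used for bounded imaginary parts only;
for large imaginary parts the Green function decays for every potential
(`enorm_boxGreen_le_half_pow`).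
-/

/-! ### Green functions of finite boxes -/

/-- The matrix entries of `-Δ + U - z` on `ℤ^d`. The hopping part is a sum over the
directions, in the same form as in `schrodingerMap`. -/
def schrodingerKernel {d : ℕ} (U : Site d → ℝ) (z : ℂ) (x w : Site d) : ℂ :=
  (if w = x then (2 * d : ℂ) + U x - z else 0)
    - ∑ i : Fin d, ((if w = x + unitVec i then 1 else 0) + (if w = x - unitVec i then 1 else 0))

/-- The Green function of `-Δ + U` restricted to the finite box `Λ` with Dirichlet boundary
conditions, i.e. the inverse of the matrix `(-Δ + U - z)` compressed to `Λ`, extended by `0` to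
pairs of sites that do not both lie in `Λ`. -/
noncomputable def boxGreen {d : ℕ} (U : Site d → ℝ) (z : ℂ) (Λ : Finset (Site d))
    (x y : Site d) : ℂ :=
  if h : x ∈ Λ ∧ y ∈ Λ then
    (Matrix.of fun v w : Λ => schrodingerKernel U z v w)⁻¹ ⟨x, h.1⟩ ⟨y, h.2⟩ else 0

section Kernel

variable {d : ℕ} {U : Site d → ℝ} {z : ℂ} {Λ : Finset (Site d)}

lemma schrodingerKernel_comm (U : Site d → ℝ) (z : ℂ) (x w : Site d) :
    schrodingerKernel U z x w = schrodingerKernel U z w x := by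
  unfold schrodingerKernel
  congr 1
  · by_cases h : w = x
    · subst h; rfl
    · rw [if_neg h, if_neg (Ne.symm h)]
  · refine Finset.sum_congr rfl fun i _ => ?_
    rw [add_comm]
    congr 1
    · exact if_congr ⟨fun h => by rw [h]; abel, fun h => by rw [h]; abel⟩ rfl rfl
    · exact if_congr ⟨fun h => by rw [h]; abel, fun h => by rw [h]; abel⟩ rfl rfl

lemma conj_schrodingerKernel (U : Site d → ℝ) (z : ℂ) (x w : Site d) :
    starRingEnd ℂ (schrodingerKernel U z x w)
      = schrodingerKernel U z x w + if w = x then z - starRingEnd ℂ z else 0 := by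
  unfold schrodingerKernel
  by_cases h : w = x
  · simp [h, apply_ite (starRingEnd ℂ), Complex.conj_ofNat]
    ring
  · simp [h, apply_ite (starRingEnd ℂ)]

lemma schrodingerKernel_congr {U U' : Site d → ℝ} (z : ℂ) {x w : Site d}
    (h : w = x → U x = U' x) : schrodingerKernel U z x w = schrodingerKernel U' z x w := by
  unfold schrodingerKernel
  congr 1
  by_cases hw : w = x
  · rw [h hw]
  · rw [if_neg hw, if_neg hw]

lemma sum_schrodingerKernel_mul (x : Site d) (ψ : Site d → ℂ) (hψ : ∀ w ∉ Λ, ψ w = 0) :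
    ∑ w ∈ Λ, schrodingerKernel U z x w * ψ w = ((2 * d : ℂ) + U x - z) * ψ x
      - ∑ i : Fin d, (ψ (x + unitVec i) + ψ (x - unitVec i)) := by
  have key : ∀ (a : Site d) (c : ℂ), ∑ w ∈ Λ, (if w = a then c else 0) * ψ w = c * ψ a := by
    intro a c
    simp only [ite_mul, zero_mul, Finset.sum_ite_eq']
    split_ifs with h
    · rfl
    · rw [hψ a h, mul_zero]
  simp only [schrodingerKernel, sub_mul, Finset.sum_mul, add_mul, Finset.sum_sub_distrib]
  rw [key, Finset.sum_comm]
  simp only [Finset.sum_add_distrib, key, one_mul]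
  ring

/-- The imaginary part of the quadratic form of `-Δ + U - z` on a box is `-Im z` times the squared
norm, so that the equation `(-Δ + U - z) ψ = h` on the box controls `ψ` by `h`. -/
lemma im_mul_sum_normSq_le (ψ h : Site d → ℂ)
    (hψ : ∀ x ∈ Λ, ∑ w ∈ Λ, schrodingerKernel U z x w * ψ w = h x) :
    z.im * ∑ x ∈ Λ, ‖ψ x‖ ^ 2 ≤ ‖∑ x ∈ Λ, starRingEnd ℂ (ψ x) * h x‖ := by
  set Q := ∑ x ∈ Λ, starRingEnd ℂ (ψ x) * h x with hQ
  have hQ' : Q = ∑ x ∈ Λ, ∑ w ∈ Λ, starRingEnd ℂ (ψ x) * schrodingerKernel U z x w * ψ w := by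
    refine Finset.sum_congr rfl fun x hx => ?_
    rw [← hψ x hx, Finset.mul_sum]
    exact Finset.sum_congr rfl fun w _ => by ring
  have hconj : starRingEnd ℂ Q = Q + (z - starRingEnd ℂ z) * ∑ x ∈ Λ, (‖ψ x‖ ^ 2 : ℂ) := by
    rw [hQ', map_sum, Finset.mul_sum]
    simp only [map_sum, map_mul, Complex.conj_conj, conj_schrodingerKernel]
    rw [Finset.sum_comm, ← Finset.sum_add_distrib]
    refine Finset.sum_congr rfl fun x hx => ?_
    have : (z - starRingEnd ℂ z) * (‖ψ x‖ ^ 2 : ℂ)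
        = ∑ w ∈ Λ, starRingEnd ℂ (ψ x) * (if w = x then z - starRingEnd ℂ z else 0) * ψ w := by
      simp only [mul_ite, ite_mul, mul_zero, zero_mul, Finset.sum_ite_eq', if_pos hx]
      rw [← Complex.conj_mul']
      ring
    rw [this, ← Finset.sum_add_distrib]
    refine Finset.sum_congr rfl fun w _ => ?_
    rw [schrodingerKernel_comm U z w x]
    by_cases hw : w = x
    · subst hw; simp; ring
    · rw [if_neg hw, if_neg (Ne.symm hw)]; ring
  have him := congrArg Complex.im hconj
  have h1 : (∑ x ∈ Λ, (‖ψ x‖ ^ 2 : ℂ)) = ((∑ x ∈ Λ, ‖ψ x‖ ^ 2 : ℝ) : ℂ) := by push_cast; rfl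
  rw [h1] at him
  simp only [Complex.conj_im, Complex.add_im, Complex.mul_im, Complex.ofReal_re,
    Complex.ofReal_im, Complex.sub_im, mul_zero, zero_add] at him
  have h2 := Complex.abs_im_le_norm Q
  have h3 := neg_le_abs Q.im
  linarith

lemma eq_zero_of_sum_schrodingerKernel_eq_zero (hz : 0 < z.im) (ψ : Site d → ℂ)
    (hψ : ∀ x ∈ Λ, ∑ w ∈ Λ, schrodingerKernel U z x w * ψ w = 0) : ∀ x ∈ Λ, ψ x = 0 := by
  have h := im_mul_sum_normSq_le ψ 0 hψ
  simp only [Pi.zero_apply, mul_zero, Finset.sum_const_zero, norm_zero] at h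
  have h1 : ∑ x ∈ Λ, ‖ψ x‖ ^ 2 = 0 :=
    le_antisymm (nonpos_of_mul_nonpos_right h hz) (Finset.sum_nonneg fun _ _ => by positivity)
  intro x hx
  have := (Finset.sum_eq_zero_iff_of_nonneg fun _ _ => by positivity).1 h1 x hx
  simpa using this

lemma isUnit_schrodingerKernel_matrix (U : Site d → ℝ) (Λ : Finset (Site d)) (hz : 0 < z.im) :
    IsUnit (Matrix.of fun v w : Λ => schrodingerKernel U z v w).det := by
  rw [isUnit_iff_ne_zero]
  intro hdet
  obtain ⟨v, hv, hMv⟩ := Matrix.exists_mulVec_eq_zero_iff.2 hdet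
  refine hv (funext fun x => ?_)
  have := eq_zero_of_sum_schrodingerKernel_eq_zero (Λ := Λ) (U := U) hz
    (fun w => if h : w ∈ Λ then v ⟨w, h⟩ else 0) (fun x hx => by
      have h1 := congrFun hMv ⟨x, hx⟩
      rw [← Finset.sum_coe_sort]
      simpa [Matrix.mulVec, dotProduct] using h1) x x.2
  simpa using this

lemma boxGreen_of_notMem_left {x : Site d} (hx : x ∉ Λ) (y : Site d) :
    boxGreen U z Λ x y = 0 := dif_neg fun h => hx h.1

lemma boxGreen_of_notMem_right (x : Site d) {y : Site d} (hy : y ∉ Λ) :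
    boxGreen U z Λ x y = 0 := dif_neg fun h => hy h.2

lemma boxGreen_comm (U : Site d → ℝ) (z : ℂ) (Λ : Finset (Site d)) (x y : Site d) :
    boxGreen U z Λ x y = boxGreen U z Λ y x := by
  unfold boxGreen
  by_cases h : x ∈ Λ ∧ y ∈ Λ
  · rw [dif_pos h, dif_pos h.symm]
    set A := Matrix.of fun v w : Λ => schrodingerKernel U z v w with hA
    have hAt : A.transpose = A := by
      ext v w
      exact schrodingerKernel_comm U z w v
    have hinv : (A⁻¹).transpose = A⁻¹ := by rw [Matrix.transpose_nonsing_inv, hAt]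
    exact congrFun (congrFun hinv ⟨y, h.2⟩) ⟨x, h.1⟩
  · rw [dif_neg h, dif_neg fun h' => h h'.symm]

lemma sum_schrodingerKernel_mul_boxGreen (hz : 0 < z.im) {x : Site d} (hx : x ∈ Λ) (y : Site d) :
    ∑ w ∈ Λ, schrodingerKernel U z x w * boxGreen U z Λ w y = if x = y then 1 else 0 := by
  by_cases hy : y ∈ Λ
  · have h := congrFun (congrFun (Matrix.mul_nonsing_inv _
      (isUnit_schrodingerKernel_matrix U Λ hz)) ⟨x, hx⟩) ⟨y, hy⟩
    rw [Matrix.mul_apply, Matrix.one_apply] at h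
    rw [← Finset.sum_coe_sort]
    simpa [boxGreen, hy] using h
  · rw [if_neg fun h : x = y => hy (h ▸ hx)]
    exact Finset.sum_eq_zero fun w _ => by rw [boxGreen_of_notMem_right w hy, mul_zero]

lemma sum_boxGreen_mul_schrodingerKernel (hz : 0 < z.im) (x : Site d) {y : Site d} (hy : y ∈ Λ) :
    ∑ w ∈ Λ, boxGreen U z Λ x w * schrodingerKernel U z w y = if x = y then 1 else 0 := by
  have h := sum_schrodingerKernel_mul_boxGreen (U := U) hz hy x
  rw [if_congr (eq_comm (a := x)) rfl rfl, ← h]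
  refine Finset.sum_congr rfl fun w _ => ?_
  rw [boxGreen_comm, schrodingerKernel_comm, mul_comm]

lemma eq_sum_boxGreen_mul (hz : 0 < z.im) {ψ h : Site d → ℂ}
    (hψ : ∀ x ∈ Λ, ∑ w ∈ Λ, schrodingerKernel U z x w * ψ w = h x) {x : Site d} (hx : x ∈ Λ) :
    ψ x = ∑ w ∈ Λ, boxGreen U z Λ x w * h w := by
  have h1 : ∀ w ∈ Λ, boxGreen U z Λ x w * h w
      = ∑ v ∈ Λ, boxGreen U z Λ x w * schrodingerKernel U z w v * ψ v := by
    intro w hw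
    rw [← hψ w hw, Finset.mul_sum]
    exact Finset.sum_congr rfl fun v _ => by ring
  rw [Finset.sum_congr rfl h1, Finset.sum_comm]
  have h2 : ∀ v ∈ Λ, ∑ w ∈ Λ, boxGreen U z Λ x w * schrodingerKernel U z w v * ψ v
      = if x = v then ψ v else 0 := by
    intro v hv
    rw [← Finset.sum_mul, sum_boxGreen_mul_schrodingerKernel hz x hv]
    split_ifs <;> simp
  rw [Finset.sum_congr rfl h2, Finset.sum_ite_eq, if_pos hx]

lemma norm_boxGreen_le (hz : 0 < z.im) (x y : Site d) : ‖boxGreen U z Λ x y‖ ≤ 1 / z.im := by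
  by_cases hxy : x ∈ Λ ∧ y ∈ Λ
  swap
  · rw [boxGreen, dif_neg hxy, norm_zero]
    positivity
  have h := im_mul_sum_normSq_le (U := U) (fun x => boxGreen U z Λ x y) _
    fun v hv => sum_schrodingerKernel_mul_boxGreen hz hv y
  simp only [mul_ite, mul_one, mul_zero, Finset.sum_ite_eq', if_pos hxy.2, RCLike.norm_conj] at h
  have hle : ∀ v ∈ Λ, z.im * ‖boxGreen U z Λ v y‖ ^ 2 ≤ ‖boxGreen U z Λ y y‖ := fun v hv =>
    (mul_le_mul_of_nonneg_left (Finset.single_le_sum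
      (f := fun v => ‖boxGreen U z Λ v y‖ ^ 2) (fun _ _ => by positivity) hv) hz.le).trans h
  have hyy : ‖boxGreen U z Λ y y‖ ≤ 1 / z.im := by
    rw [le_div_iff₀ hz]
    nlinarith [hle y hxy.2, norm_nonneg (boxGreen U z Λ y y)]
  refine abs_le_of_sq_le_sq' ?_ (by positivity) |>.2
  have h1 := hle x hxy.1
  rw [div_pow, one_pow, le_div_iff₀ (by positivity)]
  rw [le_div_iff₀ hz] at hyy
  nlinarith

lemma sum_normSq_boxGreen_le (hz : 0 < z.im) (x : Site d) :
    ∑ y ∈ Λ, ‖boxGreen U z Λ x y‖ ^ 2 ≤ (1 / z.im) ^ 2 := by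
  by_cases hx : x ∈ Λ
  swap
  · rw [Finset.sum_eq_zero fun y _ => by rw [boxGreen_of_notMem_left hx]; simp]
    positivity
  have h := im_mul_sum_normSq_le (U := U) (fun y => boxGreen U z Λ y x) _
    fun v hv => sum_schrodingerKernel_mul_boxGreen hz hv x
  simp only [mul_ite, mul_one, mul_zero, Finset.sum_ite_eq', if_pos hx, RCLike.norm_conj] at h
  have h1 := h.trans (norm_boxGreen_le hz x x)
  simp only [boxGreen_comm U z Λ x]
  rw [pow_two, div_mul_eq_mul_div, one_mul, le_div_iff₀ hz]
  linarith

/-- The box Green function only depends on the potential in the box. -/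
lemma boxGreen_congr {U U' : Site d → ℝ} (z : ℂ) (h : ∀ w ∈ Λ, U w = U' w) (x y : Site d) :
    boxGreen U z Λ x y = boxGreen U' z Λ x y := by
  have : (Matrix.of fun v w : Λ => schrodingerKernel U z v w)
      = Matrix.of fun v w : Λ => schrodingerKernel U' z v w := by
    ext v w
    exact schrodingerKernel_congr z fun _ => h v v.2
  unfold boxGreen
  rw [this]

lemma measurable_boxGreen (z : ℂ) (Λ : Finset (Site d)) (x y : Site d) :
    Measurable fun U : Site d → ℝ => boxGreen U z Λ x y := by
  unfold boxGreen
  split_ifs with h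
  · have hc : Continuous fun U : Site d → ℝ =>
        (Matrix.of fun v w : Λ => schrodingerKernel U z v w) := by
      refine continuous_matrix fun v w => ?_
      simp only [schrodingerKernel, Matrix.of_apply]
      split_ifs <;> fun_prop
    simp only [Matrix.inv_def, Ring.inverse_eq_inv', Matrix.smul_apply, smul_eq_mul]
    exact hc.matrix_det.measurable.inv.mul (hc.matrix_adjugate.matrix_elem _ _).measurable
  · exact measurable_const

/-- The geometric resolvent identity for removing a set `K` from the box: it expresses the Green
function between `K` and its complement through the Green function of the depleted box, which
does not depend on the potential in `K`. -/
lemma boxGreen_eq_neg_sum_sdiff (hz : 0 < z.im) {K : Finset (Site d)} (hK : K ⊆ Λ) {x y : Site d}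
    (hx : x ∈ K) (hy : y ∈ Λ \ K) :
    boxGreen U z Λ x y = -∑ u ∈ K, boxGreen U z Λ x u *
      ∑ v ∈ Λ \ K, schrodingerKernel U z u v * boxGreen U z (Λ \ K) v y := by
  have h0 : ∑ v ∈ Λ \ K, (∑ w ∈ Λ, boxGreen U z Λ x w * schrodingerKernel U z w v)
      * boxGreen U z (Λ \ K) v y = 0 := by
    refine Finset.sum_eq_zero fun v hv => ?_
    rw [sum_boxGreen_mul_schrodingerKernel hz x (Finset.sdiff_subset hv),
      if_neg fun h : x = v => (Finset.mem_sdiff.1 hv).2 (h ▸ hx), zero_mul]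
  have h1 : ∑ w ∈ Λ, boxGreen U z Λ x w *
      ∑ v ∈ Λ \ K, schrodingerKernel U z w v * boxGreen U z (Λ \ K) v y = 0 := by
    rw [← h0]
    simp only [Finset.mul_sum, Finset.sum_mul]
    rw [Finset.sum_comm]
    exact Finset.sum_congr rfl fun v _ => Finset.sum_congr rfl fun w _ => by ring
  rw [← Finset.sum_sdiff hK] at h1
  have h2 : ∑ w ∈ Λ \ K, boxGreen U z Λ x w *
      ∑ v ∈ Λ \ K, schrodingerKernel U z w v * boxGreen U z (Λ \ K) v y
      = boxGreen U z Λ x y := by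
    rw [Finset.sum_congr rfl fun w hw => by rw [sum_schrodingerKernel_mul_boxGreen hz hw y]]
    simp [Finset.mem_sdiff.1 hy]
  rw [h2] at h1
  exact eq_neg_of_add_eq_zero_left h1

/-- The self-energy of a set `S ⊆ Λ`: the correction to the kernel on `S` caused by the sites of
`Λ \ S`. -/
noncomputable def selfEnergy (U : Site d → ℝ) (z : ℂ) (Λ S : Finset (Site d)) (p r : Site d) : ℂ :=
  ∑ v ∈ Λ \ S, ∑ w ∈ Λ \ S,
    schrodingerKernel U z p v * boxGreen U z (Λ \ S) v w * schrodingerKernel U z w r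

lemma selfEnergy_comm (U : Site d → ℝ) (z : ℂ) (Λ S : Finset (Site d)) (p r : Site d) :
    selfEnergy U z Λ S p r = selfEnergy U z Λ S r p := by
  unfold selfEnergy
  rw [Finset.sum_comm]
  refine Finset.sum_congr rfl fun v _ => Finset.sum_congr rfl fun w _ => ?_
  rw [boxGreen_comm, schrodingerKernel_comm U z p, schrodingerKernel_comm U z v]
  ring

/-- The self-energy of `S` does not depend on the potential in `S`. -/
lemma selfEnergy_congr {U U' : Site d → ℝ} (z : ℂ) {S : Finset (Site d)}
    (h : ∀ w ∉ S, U w = U' w) {p r : Site d} (hp : p ∈ S) (hr : r ∈ S) :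
    selfEnergy U z Λ S p r = selfEnergy U' z Λ S p r := by
  refine Finset.sum_congr rfl fun v hv => Finset.sum_congr rfl fun w hw => ?_
  have hv' := (Finset.mem_sdiff.1 hv).2
  have hw' := (Finset.mem_sdiff.1 hw).2
  rw [schrodingerKernel_congr z fun e : v = p => absurd (e ▸ hp) hv',
    schrodingerKernel_congr z fun e : r = w => absurd (e ▸ hr) hw',
    boxGreen_congr z fun w hw => h w (Finset.mem_sdiff.1 hw).2]

/-- Schur complement: on a subset `S` of the box, the Green function inverts the kernel corrected
by the self-energy. -/
lemma sum_kernel_sub_selfEnergy_mul_boxGreen (hz : 0 < z.im) {S : Finset (Site d)} (hS : S ⊆ Λ)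
    {p q : Site d} (hp : p ∈ S) (hq : q ∈ S) :
    ∑ r ∈ S, (schrodingerKernel U z p r - selfEnergy U z Λ S p r) * boxGreen U z Λ r q
      = if p = q then 1 else 0 := by
  unfold selfEnergy
  rw [← sum_schrodingerKernel_mul_boxGreen (U := U) hz (hS hp) q, ← Finset.sum_sdiff hS]
  have h1 : ∀ v ∈ Λ \ S, boxGreen U z Λ v q = -∑ r ∈ S, (∑ w ∈ Λ \ S,
      boxGreen U z (Λ \ S) v w * schrodingerKernel U z w r) * boxGreen U z Λ r q := by
    intro v hv
    rw [eq_sum_boxGreen_mul (U := U) (Λ := Λ \ S) (ψ := fun v => boxGreen U z Λ v q)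
      (h := fun v => -∑ r ∈ S, schrodingerKernel U z v r * boxGreen U z Λ r q) hz
      (fun x hx => ?_) hv]
    · simp only [mul_neg, Finset.sum_neg_distrib, Finset.mul_sum, Finset.sum_mul]
      rw [Finset.sum_comm]
      simp only [mul_assoc]
    · have := sum_schrodingerKernel_mul_boxGreen (U := U) hz (Finset.sdiff_subset hx) q
      rw [← Finset.sum_sdiff hS, if_neg fun h : x = q => (Finset.mem_sdiff.1 hx).2 (h ▸ hq)] at this
      exact eq_neg_of_add_eq_zero_left this
  rw [Finset.sum_congr (s₁ := Λ \ S) rfl fun v hv => by rw [h1 v hv]]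
  simp only [mul_neg, Finset.sum_neg_distrib, sub_mul, Finset.sum_sub_distrib, Finset.mul_sum,
    Finset.sum_mul]
  rw [neg_add_eq_sub]
  congr 1
  rw [Finset.sum_comm]
  exact Finset.sum_congr rfl fun v _ => Finset.sum_congr rfl fun r _ =>
    Finset.sum_congr rfl fun w _ => by ring

lemma schrodingerKernel_self_sub (U U' : Site d → ℝ) (z : ℂ) (x : Site d) :
    schrodingerKernel U' z x x = U' x - (U x - schrodingerKernel U z x x) := by
  simp only [schrodingerKernel, if_true]
  ring

/-- As a function of the potential at `x` alone, `G(x, x) = (U x - a)⁻¹`. -/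
lemma exists_sub_mul_boxGreen_self (hz : 0 < z.im) (U : Site d → ℝ) {x : Site d} (hx : x ∈ Λ) :
    ∃ a : ℂ, ∀ U' : Site d → ℝ, (∀ w, w ≠ x → U w = U' w) →
      (U' x - a) * boxGreen U' z Λ x x = 1 := by
  refine ⟨U x - schrodingerKernel U z x x + selfEnergy U z Λ {x} x x, fun U' hU => ?_⟩
  have h := sum_kernel_sub_selfEnergy_mul_boxGreen (U := U') hz
    (Finset.singleton_subset_iff.2 hx) (Finset.mem_singleton_self x) (Finset.mem_singleton_self x)
  rw [Finset.sum_singleton, if_pos rfl, schrodingerKernel_self_sub U U',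
    ← selfEnergy_congr z (U := U) (fun w hw => hU w (by simpa using hw))
      (Finset.mem_singleton_self x) (Finset.mem_singleton_self x)] at h
  rw [← h]
  ring

/-- As a function of the potentials at `x` and `u`, the column of the Green function at `x` solves
a two by two system with matrix `diag (U x, U u)` minus a symmetric matrix which does not depend
on these two potentials. -/
lemma exists_boxGreen_pair (hz : 0 < z.im) (U : Site d → ℝ) {x u : Site d} (hx : x ∈ Λ)
    (hu : u ∈ Λ) (hxu : x ≠ u) :
    ∃ a b e : ℂ, ∀ U' : Site d → ℝ, (∀ w, w ≠ x → w ≠ u → U w = U' w) →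
      (U' x - a) * boxGreen U' z Λ x x + b * boxGreen U' z Λ x u = 1 ∧
      b * boxGreen U' z Λ x x + (U' u - e) * boxGreen U' z Λ x u = 0 := by
  have hS : ({x, u} : Finset (Site d)) ⊆ Λ := by
    intro w hw
    rcases Finset.mem_insert.1 hw with rfl | hw
    · exact hx
    · rwa [Finset.mem_singleton.1 hw]
  have hxS : x ∈ ({x, u} : Finset (Site d)) := by simp
  have huS : u ∈ ({x, u} : Finset (Site d)) := by simp
  set Q := selfEnergy U z Λ {x, u} with hQ
  refine ⟨U x - schrodingerKernel U z x x + Q x x, schrodingerKernel U z x u - Q x u,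
    U u - schrodingerKernel U z u u + Q u u, fun U' hU => ?_⟩
  have hU' : ∀ w ∉ ({x, u} : Finset (Site d)), U w = U' w := fun w hw => by
    simp only [Finset.mem_insert, Finset.mem_singleton, not_or] at hw
    exact hU w hw.1 hw.2
  have h1 := sum_kernel_sub_selfEnergy_mul_boxGreen (U := U') hz hS hxS hxS
  have h2 := sum_kernel_sub_selfEnergy_mul_boxGreen (U := U') hz hS huS hxS
  rw [Finset.sum_pair hxu, ← selfEnergy_congr z hU' hxS hxS, ← selfEnergy_congr z hU' hxS huS,
    schrodingerKernel_self_sub U U', ← schrodingerKernel_congr (U := U) z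
      fun e : u = x => absurd e.symm hxu, ← hQ, if_pos rfl, boxGreen_comm U' z Λ u x] at h1
  rw [Finset.sum_pair hxu, ← selfEnergy_congr z hU' huS huS, ← selfEnergy_congr z hU' huS hxS,
    schrodingerKernel_self_sub U U', ← schrodingerKernel_congr (U := U) z
      fun e : x = u => absurd e hxu, ← hQ, if_neg hxu.symm, boxGreen_comm U' z Λ u x,
    schrodingerKernel_comm U z u x, hQ, selfEnergy_comm U z Λ _ u x, ← hQ] at h2
  constructor
  · rw [← h1]; ring
  · rw [← h2]; ring

/-- The geometric resolvent identity with the kernel written out: the Green function from `K` to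
its complement is a sum over the steps by which a path can leave `K`. -/
lemma enorm_boxGreen_le_sum_sdiff (hz : 0 < z.im) {K : Finset (Site d)} (hK : K ⊆ Λ) {x y : Site d}
    (hx : x ∈ K) (hy : y ∈ Λ \ K) :
    ‖boxGreen U z Λ x y‖ₑ ≤ ∑ u ∈ K, ∑ i : Fin d,
      (‖boxGreen U z Λ x u‖ₑ * ‖boxGreen U z (Λ \ K) (u + unitVec i) y‖ₑ
        + ‖boxGreen U z Λ x u‖ₑ * ‖boxGreen U z (Λ \ K) (u - unitVec i) y‖ₑ) := by
  rw [boxGreen_eq_neg_sum_sdiff hz hK hx hy, enorm_neg]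
  refine (enorm_sum_le _ _).trans (Finset.sum_le_sum fun u hu => ?_)
  rw [sum_schrodingerKernel_mul u _ fun w hw => boxGreen_of_notMem_left hw y,
    boxGreen_of_notMem_left (fun h => (Finset.mem_sdiff.1 h).2 hu) y, mul_zero, zero_sub,
    mul_neg, enorm_neg, enorm_mul]
  simp only [← mul_add, ← Finset.mul_sum]
  gcongr
  refine (enorm_sum_le _ _).trans (Finset.sum_le_sum fun i _ => enorm_add_le _ _)

end Kernel

/-! ### Fractional moments of one-site and two-site resolvents -/

/-- Regularity of `μ` makes the inverse moments of the distance to a point finite, uniformly in the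
point. The inverse is taken in `ℝ≥0∞`, so that it is `∞` at the point itself. -/
lemma exists_lintegral_inv_enorm_sub_rpow_le {μ : Measure ℝ} [IsProbabilityMeasure μ] {α C : ℝ}
    (hμ : ∀ ε : ℝ, 0 < ε → ∀ t : ℝ,
      μ (Set.Icc (t - ε) (t + ε)) ≤ ENNReal.ofReal (C * ε ^ α))
    {s : ℝ} (hs : 0 < s) (hsα : s < α) :
    ∃ c : ℝ≥0∞, c ≠ ∞ ∧ ∀ τ : ℝ, ∫⁻ t, ‖t - τ‖ₑ⁻¹ ^ s ∂μ ≤ c := by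
  refine ⟨1 + ∑' k : ℕ, ENNReal.ofReal (2 ^ s * C * ((2 : ℝ) ^ (s - α)) ^ k), ?_, fun τ => ?_⟩
  · refine ENNReal.add_ne_top.2 ⟨ENNReal.one_ne_top, Summable.tsum_ofReal_ne_top ?_⟩
    exact (summable_geometric_of_lt_one (by positivity)
      (Real.rpow_lt_one_of_one_lt_of_neg one_lt_two (by linarith))).mul_left _
  -- Dyadic decomposition of the distance to `τ`.
  have hpt : ∀ t, ‖t - τ‖ₑ⁻¹ ^ s ≤ 1 + ∑' k : ℕ,
      (Set.Icc (τ - (1 / 2) ^ k) (τ + (1 / 2) ^ k)).indicator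
      (fun _ => ENNReal.ofReal ((2 ^ (k + 1) : ℝ) ^ s)) t := by
    intro t
    rcases eq_or_ne t τ with rfl | hne
    · refine le_top.trans (le_of_eq ?_)
      have : ∑' k : ℕ, (Set.Icc (t - (1 / 2) ^ k) (t + (1 / 2) ^ k)).indicator
          (fun _ => ENNReal.ofReal ((2 ^ (k + 1) : ℝ) ^ s)) t = ∞ := by
        refine top_le_iff.1 ((le_of_eq (ENNReal.tsum_const_eq_top_of_ne_zero (α := ℕ)
          one_ne_zero).symm).trans (ENNReal.tsum_le_tsum fun k => ?_))
        rw [Set.indicator_of_mem (s := Set.Icc (t - (1 / 2) ^ k) (t + (1 / 2) ^ k))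
          ⟨by simp, by simp⟩, ENNReal.one_le_ofReal]
        exact Real.one_le_rpow (one_le_pow₀ one_le_two) hs.le
      rw [this, add_top]
    have hpos : 0 < |t - τ| := abs_pos.2 (sub_ne_zero.2 hne)
    by_cases h1 : |t - τ| ≤ 1
    · obtain ⟨k, hk1, hk2⟩ := exists_nat_pow_near_of_lt_one hpos h1 one_half_pos one_half_lt_one
      refine le_trans ?_ (le_add_left (ENNReal.le_tsum k))
      rw [Set.indicator_of_mem]
      · rw [← ENNReal.ofReal_rpow_of_pos (by positivity)]
        gcongr
        rw [← ofReal_norm, ← ENNReal.ofReal_inv_of_pos (by simpa using hpos)]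
        refine ENNReal.ofReal_le_ofReal ?_
        rw [Real.norm_eq_abs]
        refine (inv_anti₀ (by positivity) hk1.le).trans (le_of_eq ?_)
        simp
      · have := abs_le.1 hk2
        constructor <;> linarith [this.1, this.2]
    · refine le_add_right (ENNReal.rpow_le_one ?_ hs.le)
      rw [ENNReal.inv_le_one, ← ofReal_norm, ENNReal.one_le_ofReal, Real.norm_eq_abs]
      exact (not_le.1 h1).le
  refine (lintegral_mono hpt).trans ?_
  rw [lintegral_add_left measurable_const, lintegral_const, measure_univ, mul_one,
    lintegral_tsum fun k => (measurable_const.indicator measurableSet_Icc).aemeasurable]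
  gcongr with k
  rw [lintegral_indicator_const measurableSet_Icc]
  calc ENNReal.ofReal ((2 ^ (k + 1) : ℝ) ^ s) * μ (Set.Icc (τ - (1 / 2) ^ k) (τ + (1 / 2) ^ k))
      ≤ ENNReal.ofReal ((2 ^ (k + 1) : ℝ) ^ s) * ENNReal.ofReal (C * ((1 / 2) ^ k) ^ α) := by
        gcongr
        exact hμ _ (by positivity) τ
    _ = ENNReal.ofReal (2 ^ s * C * ((2 : ℝ) ^ (s - α)) ^ k) := by
        rw [← ENNReal.ofReal_mul (by positivity)]
        congr 1
        have e1 : ((2 : ℝ) ^ (k + 1)) ^ s = 2 ^ s * 2 ^ (s * k) := by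
          rw [← Real.rpow_natCast, ← Real.rpow_mul zero_le_two, ← Real.rpow_add two_pos]
          push_cast; ring_nf
        have e2 : (((1 : ℝ) / 2) ^ k) ^ α = 2 ^ (-α * k) := by
          rw [one_div, inv_pow, ← Real.rpow_natCast, ← Real.rpow_neg zero_le_two,
            ← Real.rpow_mul zero_le_two]
          ring_nf
        have e3 : ((2 : ℝ) ^ (s - α)) ^ k = 2 ^ (s * k) * 2 ^ (-α * k) := by
          rw [← Real.rpow_natCast, ← Real.rpow_mul zero_le_two, ← Real.rpow_add two_pos]
          ring_nf
        rw [e1, e2, e3]; ring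

/-- A potential of strength `g` gains a factor `g ^ (-s)`; the point `w` may be complex, since only
its real part matters for a lower bound on the distance. -/
lemma lintegral_inv_sub_rpow_le {μ : Measure ℝ} {s : ℝ} (hs : 0 < s) {c : ℝ≥0∞}
    (hc : ∀ τ : ℝ, ∫⁻ t, ‖t - τ‖ₑ⁻¹ ^ s ∂μ ≤ c) {g : ℝ} (hg : 0 < g) (v : ℝ) (w : ℂ) :
    ∫⁻ t, ‖((v + g * t : ℝ) : ℂ) - w‖ₑ⁻¹ ^ s ∂μ ≤ (ENNReal.ofReal g)⁻¹ ^ s * c := by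
  have hg0 : ENNReal.ofReal g ≠ 0 := by simpa using hg
  have hpt : ∀ t : ℝ, ‖((v + g * t : ℝ) : ℂ) - w‖ₑ⁻¹ ^ s
      ≤ (ENNReal.ofReal g)⁻¹ ^ s * ‖t - (w.re - v) / g‖ₑ⁻¹ ^ s := by
    intro t
    rw [← ENNReal.mul_rpow_of_nonneg _ _ hs.le, ← ENNReal.mul_inv (Or.inl hg0)
      (Or.inl ENNReal.ofReal_ne_top)]
    gcongr
    rw [← ofReal_norm, ← ofReal_norm, ← ENNReal.ofReal_mul hg.le]
    refine ENNReal.ofReal_le_ofReal ?_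
    refine le_trans (le_of_eq ?_) (Complex.abs_re_le_norm _)
    rw [Complex.sub_re, Complex.ofReal_re, Real.norm_eq_abs]
    nth_rewrite 1 [← abs_of_pos hg]
    rw [← abs_mul]
    congr 1
    field_simp
    ring
  refine (lintegral_mono hpt).trans ?_
  have : Measurable fun t : ℝ => ‖t - (w.re - v) / g‖ₑ⁻¹ ^ s := by fun_prop
  rw [lintegral_const_mul _ this]
  gcongr
  exact hc _

/-- The off-diagonal entry `C` of the inverse of the symmetric matrix `(p b; b r)` is bounded by
one of three expressions, each of which is the inverse of an affine function of `p` or of `r`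
whose constant term is determined by the other variable. -/
lemma enorm_rpow_le_of_pair_eq {p r b A C : ℂ} (h1 : p * A + b * C = 1) (h2 : b * A + r * C = 0)
    {s : ℝ} (hs : 0 < s) :
    ‖C‖ₑ ^ s ≤ (2 * ‖p - b ^ 2 / r‖ₑ⁻¹) ^ s + (2 * ‖r - b ^ 2 / p‖ₑ⁻¹) ^ s + ‖r‖ₑ⁻¹ ^ s := by
  have hC : C * (b ^ 2 - p * r) = b := by linear_combination b * h1 - p * h2
  have key : ∀ q D : ℂ, C * D = q → ‖q‖ ≤ 2 → ‖C‖ₑ ≤ 2 * ‖D‖ₑ⁻¹ := by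
    intro q D hq hq2
    rcases eq_or_ne D 0 with rfl | hD
    · simp
    rw [← div_eq_mul_inv, ENNReal.le_div_iff_mul_le (Or.inl (by simpa using hD))
      (Or.inl enorm_ne_top), ← enorm_mul, hq, ← ofReal_norm]
    simpa using ENNReal.ofReal_le_ofReal hq2
  by_cases hr0 : r = 0
  · simp [hr0, hs]
  by_cases hr : ‖b‖ ≤ 2 * ‖r‖
  · refine le_add_right (le_add_right ?_)
    gcongr
    refine key (-(b / r)) _ ?_ ?_
    · field_simp
      linear_combination -hC
    · rw [norm_neg, norm_div, div_le_iff₀ (norm_pos_iff.2 hr0)]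
      exact hr
  by_cases hp0 : p = 0
  · refine le_add_left ?_
    gcongr
    have hb : b ≠ 0 := fun hb => by simp [hp0, hb] at h1
    have hCb : C * b = 1 := by
      rw [hp0] at h1
      linear_combination h1
    rw [← mul_one ‖C‖ₑ]
    rw [← enorm_inv hr0]
    rw [mul_one, enorm_le_iff_norm_le, eq_inv_of_mul_eq_one_left hCb, norm_inv, norm_inv]
    exact inv_anti₀ (norm_pos_iff.2 hr0) (by linarith [norm_nonneg r])
  by_cases hp : ‖b‖ ≤ 2 * ‖p‖
  · refine le_add_right (le_add_left ?_)
    gcongr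
    refine key (-(b / p)) _ ?_ ?_
    · field_simp
      linear_combination -hC
    · rw [norm_neg, norm_div, div_le_iff₀ (norm_pos_iff.2 hp0)]
      exact hp
  -- If `b` dominates both diagonal entries, then `C` is of size `1 / |b|`, hence at most `1 / |r|`.
  · refine le_add_left ?_
    gcongr
    rw [← enorm_inv hr0, enorm_le_iff_norm_le, norm_inv, ← one_div,
      le_div_iff₀ (norm_pos_iff.2 hr0)]
    have h3 : ‖C‖ * ‖b ^ 2 - p * r‖ = ‖b‖ := by rw [← norm_mul, hC]
    have h4 : ‖b‖ ^ 2 - ‖p‖ * ‖r‖ ≤ ‖b ^ 2 - p * r‖ := by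
      rw [← norm_pow, ← norm_mul]
      exact norm_sub_norm_le (b ^ 2) (p * r)
    push Not at hr hp
    have h5 : 0 < ‖p‖ := norm_pos_iff.2 hp0
    have h6 : 0 < ‖r‖ := norm_pos_iff.2 hr0
    have h7 : ‖b‖ * ‖r‖ ≤ ‖b ^ 2 - p * r‖ := by nlinarith
    have h8 : ‖C‖ * (‖b‖ * ‖r‖) ≤ ‖b‖ :=
      (mul_le_mul_of_nonneg_left h7 (norm_nonneg C)).trans h3.le
    have h9 : 0 < ‖b‖ := by linarith
    nlinarith

/-- Averaging the bound of `enorm_rpow_le_of_pair_eq` over both potentials: each of its three terms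
is averaged first over the variable in which it is the inverse of an affine function. -/
lemma lintegral_pair_le {μ : Measure ℝ} [IsProbabilityMeasure μ] {s : ℝ} (hs : 0 < s) {c : ℝ≥0∞}
    (hc : ∀ τ : ℝ, ∫⁻ t, ‖t - τ‖ₑ⁻¹ ^ s ∂μ ≤ c) {g : ℝ} (hg : 0 < g) (v v' : ℝ) (a b e : ℂ)
    (F : ℝ → ℝ → ℝ≥0∞) (hF : ∀ t t', F t t' ≤
      (2 * ‖(((v + g * t : ℝ) : ℂ) - a) - b ^ 2 / (((v' + g * t' : ℝ) : ℂ) - e)‖ₑ⁻¹) ^ s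
      + (2 * ‖(((v' + g * t' : ℝ) : ℂ) - e) - b ^ 2 / (((v + g * t : ℝ) : ℂ) - a)‖ₑ⁻¹) ^ s
      + ‖((v' + g * t' : ℝ) : ℂ) - e‖ₑ⁻¹ ^ s) :
    ∫⁻ t', ∫⁻ t, F t t' ∂μ ∂μ
      ≤ (2 ^ s + 2 ^ s + 1) * ((ENNReal.ofReal g)⁻¹ ^ s * c) := by
  have hm1 : Measurable fun x : ℝ × ℝ =>
      (2 * ‖(((v + g * x.2 : ℝ) : ℂ) - a) - b ^ 2 / (((v' + g * x.1 : ℝ) : ℂ) - e)‖ₑ⁻¹) ^ s := by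
    fun_prop
  have hm2 : Measurable fun x : ℝ × ℝ =>
      (2 * ‖(((v' + g * x.1 : ℝ) : ℂ) - e) - b ^ 2 / (((v + g * x.2 : ℝ) : ℂ) - a)‖ₑ⁻¹) ^ s := by
    fun_prop
  have hm3 : Measurable fun x : ℝ × ℝ => ‖((v' + g * x.1 : ℝ) : ℂ) - e‖ₑ⁻¹ ^ s := by fun_prop
  refine (lintegral_mono fun t' => lintegral_mono fun t => hF t t').trans ?_
  have hsplit : ∀ t', ∫⁻ t, (2 * ‖(((v + g * t : ℝ) : ℂ) - a)
      - b ^ 2 / (((v' + g * t' : ℝ) : ℂ) - e)‖ₑ⁻¹) ^ s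
      + (2 * ‖(((v' + g * t' : ℝ) : ℂ) - e) - b ^ 2 / (((v + g * t : ℝ) : ℂ) - a)‖ₑ⁻¹) ^ s
      + ‖((v' + g * t' : ℝ) : ℂ) - e‖ₑ⁻¹ ^ s ∂μ = _ := fun t' => by
    rw [lintegral_add_left (by fun_prop), lintegral_add_left (by fun_prop)]
  simp_rw [hsplit]
  have hM1 : Measurable fun t' : ℝ => ∫⁻ t, (2 * ‖(((v + g * t : ℝ) : ℂ) - a)
      - b ^ 2 / (((v' + g * t' : ℝ) : ℂ) - e)‖ₑ⁻¹) ^ s ∂μ := hm1.lintegral_prod_right'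
  have hM2 : Measurable fun t' : ℝ => ∫⁻ t, (2 * ‖(((v' + g * t' : ℝ) : ℂ) - e)
      - b ^ 2 / (((v + g * t : ℝ) : ℂ) - a)‖ₑ⁻¹) ^ s ∂μ := hm2.lintegral_prod_right'
  rw [lintegral_add_left (hM1.fun_add hM2), lintegral_add_left hM1, add_mul, add_mul, one_mul]
  have hone : ∀ (v : ℝ) (w : ℂ), ∫⁻ t, (2 * ‖((v + g * t : ℝ) : ℂ) - w‖ₑ⁻¹) ^ s ∂μ
      ≤ 2 ^ s * ((ENNReal.ofReal g)⁻¹ ^ s * c) := by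
    intro v w
    simp_rw [ENNReal.mul_rpow_of_nonneg _ _ hs.le]
    rw [lintegral_const_mul _ (by fun_prop)]
    gcongr
    exact lintegral_inv_sub_rpow_le hs hc hg v w
  have hconst : ∀ (f : ℝ → ℝ≥0∞) (k : ℝ≥0∞), (∀ t, f t ≤ k) → ∫⁻ t, f t ∂μ ≤ k := by
    intro f k h
    simpa using lintegral_mono (μ := μ) h
  gcongr
  · refine hconst _ _ fun t' => ?_
    simp_rw [sub_sub]
    exact hone v _
  · rw [lintegral_lintegral_swap hm2.aemeasurable]
    refine hconst _ _ fun t => ?_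
    simp_rw [sub_sub]
    exact hone v' _
  · simp only [lintegral_const, measure_univ, mul_one]
    exact lintegral_inv_sub_rpow_le hs hc hg v' e

/-! ### The graph distance -/

section Dist

variable {d : ℕ}

lemma l1dist_self (x : Site d) : l1dist x x = 0 := by simp [l1dist]

lemma l1dist_comm (x y : Site d) : l1dist x y = l1dist y x :=
  Finset.sum_congr rfl fun i _ => by omega

lemma l1dist_triangle (x y w : Site d) : l1dist x w ≤ l1dist x y + l1dist y w := by
  unfold l1dist
  rw [← Finset.sum_add_distrib]
  exact Finset.sum_le_sum fun i _ => by omega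

lemma l1dist_add_right (x y a : Site d) : l1dist (x + a) (y + a) = l1dist x y := by
  simp [l1dist]

lemma l1dist_add_unitVec (x : Site d) (i : Fin d) : l1dist x (x + unitVec i) = 1 := by
  unfold l1dist unitVec
  rw [Finset.sum_eq_single i] <;> simp +contextual

lemma l1dist_sub_unitVec (x : Site d) (i : Fin d) : l1dist x (x - unitVec i) = 1 := by
  unfold l1dist unitVec
  rw [Finset.sum_eq_single i] <;> simp +contextual

lemma natAbs_sub_le_l1dist (x y : Site d) (i : Fin d) : (x i - y i).natAbs ≤ l1dist x y :=
  Finset.single_le_sum (f := fun i => (x i - y i).natAbs) (fun _ _ => Nat.zero_le _)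
    (Finset.mem_univ i)

/-- The cube of side `2 R + 1` around `x`, which contains the `ℓ¹` ball of radius `R`. -/
noncomputable def cube (R : ℕ) (x : Site d) : Finset (Site d) :=
  Fintype.piFinset fun i => Finset.Icc (x i - R) (x i + R)

lemma mem_cube_of_l1dist_le {R : ℕ} {x w : Site d} (h : l1dist x w ≤ R) : w ∈ cube R x := by
  refine Fintype.mem_piFinset.2 fun i => ?_
  have := (natAbs_sub_le_l1dist x w i).trans h
  rw [Finset.mem_Icc]
  omega

lemma card_cube (R : ℕ) (x : Site d) : (cube R x).card = (2 * R + 1) ^ d := by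
  rw [cube, Fintype.card_piFinset]
  have : ∀ i : Fin d, (Finset.Icc (x i - R) (x i + R)).card = 2 * R + 1 := fun i => by
    rw [Int.card_Icc]; omega
  simp [this]

end Dist

/-! ### Exponential decay of fractional moments on the random sites -/

/-- A decomposition of `ℤ^d` into clusters (the fibres of `κ`) of diameter at most `R`, such that
every bond between two different clusters joins two sites of `Γ` (the condition on the second
endpoint follows by symmetry). -/
structure IsClusterMap {d : ℕ} {T : Type*} (Γ : Set (Site d)) (κ : Site d → T) (R : ℕ) : Prop where
  mem_of_ne : ∀ x w, l1dist x w = 1 → κ x ≠ κ w → x ∈ Γ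
  dist_le : ∀ x w, κ x = κ w → l1dist x w ≤ R

/-- The box `Λ` is a union of clusters. -/
def IsClusterUnion {d : ℕ} {T : Type*} (κ : Site d → T) (Λ : Finset (Site d)) : Prop :=
  ∀ x ∈ Λ, ∀ w, κ w = κ x → w ∈ Λ

lemma ENNReal.rpow_sum_le_sum_rpow {ι : Type*} (S : Finset ι) (f : ι → ℝ≥0∞) {s : ℝ} (hs : 0 < s)
    (hs1 : s ≤ 1) : (∑ i ∈ S, f i) ^ s ≤ ∑ i ∈ S, f i ^ s :=
  Finset.le_sum_of_subadditive (fun a : ℝ≥0∞ => a ^ s) (ENNReal.zero_rpow_of_pos hs).le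
    (fun a b => ENNReal.rpow_add_le_add_rpow a b hs.le hs1) S f

section Marginal

lemma lmarginal_finset_sum {ι α : Type*} [DecidableEq ι] {ν : ι → Measure ℝ}
    (A : Finset α) {S : Finset ι} {f : α → (ι → ℝ) → ℝ≥0∞}
    (hf : ∀ a ∈ A, Measurable (f a)) (v : ι → ℝ) :
    (∫⋯∫⁻_S, (fun v => ∑ a ∈ A, f a v) ∂ν) v = ∑ a ∈ A, (∫⋯∫⁻_S, f a ∂ν) v := by
  unfold lmarginal
  exact lintegral_finsetSum _ fun a ha => (hf a ha).comp measurable_updateFinset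

variable {ι : Type*} [DecidableEq ι] {ν : ι → Measure ℝ} [∀ i, IsProbabilityMeasure (ν i)]

lemma lmarginal_le_of_le {S : Finset ι} {f : (ι → ℝ) → ℝ≥0∞} {k : ℝ≥0∞} (h : ∀ v, f v ≤ k)
    (v : ι → ℝ) : (∫⋯∫⁻_S, f ∂ν) v ≤ k := by
  unfold lmarginal
  refine (lintegral_mono fun y => h _).trans ?_
  simp

lemma lmarginal_le_of_subset_of_le {S S' : Finset ι} (hS : S' ⊆ S) {f : (ι → ℝ) → ℝ≥0∞}
    (hf : Measurable f) {k : ℝ≥0∞} (h : ∀ v, (∫⋯∫⁻_S', f ∂ν) v ≤ k) (v : ι → ℝ) :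
    (∫⋯∫⁻_S, f ∂ν) v ≤ k := by
  rw [← Finset.sdiff_union_of_subset hS, lmarginal_union ν f hf Finset.sdiff_disjoint]
  exact lmarginal_le_of_le h v

/-- Decoupling: the average over `S` of a product factorizes into bounds for the factors if the
second one does not depend on the variables in `S'`, and the first one is bounded after averaging
over `S'` only. -/
lemma lmarginal_mul_le {S S' : Finset ι} (hS : S' ⊆ S) {f h : (ι → ℝ) → ℝ≥0∞}
    (hf : Measurable f) (hh : Measurable h) {k l : ℝ≥0∞} (hk : ∀ v, (∫⋯∫⁻_S', f ∂ν) v ≤ k)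
    (hl : ∀ v, (∫⋯∫⁻_S \ S', h ∂ν) v ≤ l)
    (hdep : ∀ v w, (∀ i ∉ S', v i = w i) → h v = h w) (v : ι → ℝ) :
    (∫⋯∫⁻_S, (fun v => f v * h v) ∂ν) v ≤ k * l := by
  have h1 : ∫⋯∫⁻_S', (fun v => f v * h v) ∂ν ≤ fun v => k * h v := by
    intro v
    have h2 : (∫⋯∫⁻_S', (fun v => f v * h v) ∂ν) v = (∫⋯∫⁻_S', f ∂ν) v * h v := by
      have hf' : Measurable fun y : S' → ℝ => f (Function.updateFinset v S' y) :=
        hf.comp measurable_updateFinset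
      unfold lmarginal
      rw [← lintegral_mul_const _ hf']
      refine lintegral_congr fun y => ?_
      exact congrArg (f (Function.updateFinset v S' y) * ·)
        (hdep _ v fun i hi => by simp [Function.updateFinset, hi])
    rw [h2]
    exact mul_le_mul' (hk v) le_rfl
  rw [← Finset.sdiff_union_of_subset hS, lmarginal_union ν _ (hf.fun_mul hh) Finset.sdiff_disjoint]
  refine (lmarginal_mono h1 v).trans ?_
  have h3 : (∫⋯∫⁻_S \ S', (fun v => k * h v) ∂ν) v = k * (∫⋯∫⁻_S \ S', h ∂ν) v := by
    have hh' : Measurable fun y : (S \ S' : Finset ι) → ℝ =>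
        h (Function.updateFinset v (S \ S') y) := hh.comp measurable_updateFinset
    unfold lmarginal
    rw [lintegral_const_mul _ hh']
  rw [h3]
  gcongr
  exact hl v

end Marginal

section Decay

variable {d : ℕ} {Γ : Set (Site d)} {V₀ : Site d → ℝ} {μ : Measure ℝ} [IsProbabilityMeasure μ]
  {ν : Site d → Measure ℝ} [∀ x, IsProbabilityMeasure (ν x)] {s g : ℝ} {c : ℝ≥0∞} {z : ℂ}
  {Λ : Finset (Site d)}

lemma measurable_enorm_boxGreen_rpow (V₀ : Site d → ℝ) (g : ℝ) (z : ℂ) (Λ : Finset (Site d))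
    (x y : Site d) (s : ℝ) :
    Measurable fun v : Site d → ℝ => ‖boxGreen (fun w => V₀ w + g * v w) z Λ x y‖ₑ ^ s := by
  have : Measurable fun v : Site d → ℝ => boxGreen (fun w => V₀ w + g * v w) z Λ x y :=
    (measurable_boxGreen z Λ x y).comp (by fun_prop)
  fun_prop

/-- The a priori bound: averaging over the potential at `x` and `u` only, the fractional moment of
`G(x, u)` is small at strong disorder, whatever the potential elsewhere. -/
lemma lmarginal_boxGreen_le (hν : ∀ x ∈ Γ, ν x = μ) (hs : 0 < s)
    (hc : ∀ τ : ℝ, ∫⁻ t, ‖t - τ‖ₑ⁻¹ ^ s ∂μ ≤ c) (hg : 0 < g) (hz : 0 < z.im)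
    {S : Finset (Site d)} {x u : Site d} (hx : x ∈ Γ) (hu : u ∈ Γ) (hxΛ : x ∈ Λ) (huΛ : u ∈ Λ)
    (hxS : x ∈ S) (huS : u ∈ S) (v : Site d → ℝ) :
    (∫⋯∫⁻_S, (fun v => ‖boxGreen (fun w => V₀ w + g * v w) z Λ x u‖ₑ ^ s) ∂ν) v
      ≤ (2 ^ s + 2 ^ s + 1) * ((ENNReal.ofReal g)⁻¹ ^ s * c) := by
  have hm := measurable_enorm_boxGreen_rpow V₀ g z Λ x u s
  rcases eq_or_ne x u with rfl | hxu
  · refine lmarginal_le_of_subset_of_le (Finset.singleton_subset_iff.2 hxS) hm (fun v => ?_) v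
    rw [lmarginal_singleton, hν x hx]
    obtain ⟨a, ha⟩ := exists_sub_mul_boxGreen_self hz (fun w => V₀ w + g * v w) hxΛ
    refine (lintegral_mono fun t => ?_).trans ((lintegral_inv_sub_rpow_le hs hc hg (V₀ x) a).trans
      (le_mul_of_one_le_left' (le_add_left le_rfl)))
    have h := ha (fun w => V₀ w + g * Function.update v x t w) fun w hw => by
      rw [Function.update_of_ne hw]
    simp only [Function.update_self] at h
    have h0 := left_ne_zero_of_mul_eq_one h
    simp only
    rw [eq_inv_of_mul_eq_one_right h, enorm_inv h0]
  · refine lmarginal_le_of_subset_of_le (S' := insert u {x}) ?_ hm (fun v => ?_) v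
    · exact Finset.insert_subset huS (Finset.singleton_subset_iff.2 hxS)
    rw [lmarginal_insert _ hm (by simpa using hxu.symm), hν u hu]
    simp_rw [lmarginal_singleton, hν x hx]
    obtain ⟨a, b, e, habe⟩ := exists_boxGreen_pair hz (fun w => V₀ w + g * v w) hxΛ huΛ hxu
    refine lintegral_pair_le hs hc hg (V₀ x) (V₀ u) a b e
      (fun t t' => ‖boxGreen (fun w => V₀ w + g * Function.update (Function.update v u t') x t w)
        z Λ x u‖ₑ ^ s) fun t t' => ?_
    have h := habe (fun w => V₀ w + g * Function.update (Function.update v u t') x t w)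
      fun w hw hw' => by rw [Function.update_of_ne hw, Function.update_of_ne hw']
    simp only [Function.update_self, Function.update_of_ne hxu.symm] at h
    exact enorm_rpow_le_of_pair_eq h.1 h.2 hs

/-- Exponential decay on `Γ` at strong disorder. Each removal of the cluster of the starting point
costs one factor of the a priori bound, and the number of ways to leave a cluster is bounded. -/
lemma lmarginal_boxGreen_le_half_pow {T : Type*} [DecidableEq T] {κ : Site d → T} {R : ℕ}
    (hκ : IsClusterMap Γ κ R) (hν : ∀ x ∈ Γ, ν x = μ) (hs : 0 < s) (hs1 : s ≤ 1)
    (hc : ∀ τ : ℝ, ∫⁻ t, ‖t - τ‖ₑ⁻¹ ^ s ∂μ ≤ c) (hg : 0 < g)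
    (hsmall : ((2 * R + 1) ^ d * (2 * d) : ℝ≥0∞)
      * ((2 ^ s + 2 ^ s + 1) * ((ENNReal.ofReal g)⁻¹ ^ s * c)) ≤ 2⁻¹) (hz : 0 < z.im) (n : ℕ) :
    ∀ Λ : Finset (Site d), IsClusterUnion κ Λ → ∀ x ∈ Λ, ∀ y ∈ Λ, x ∈ Γ → y ∈ Γ →
      (R + 1) * n ≤ l1dist x y → ∀ v,
      (∫⋯∫⁻_Λ, (fun v => ‖boxGreen (fun w => V₀ w + g * v w) z Λ x y‖ₑ ^ s) ∂ν) v
        ≤ (2 ^ s + 2 ^ s + 1) * ((ENNReal.ofReal g)⁻¹ ^ s * c) * 2⁻¹ ^ n := by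
  set k := (2 ^ s + 2 ^ s + 1) * ((ENNReal.ofReal g)⁻¹ ^ s * c) with hk
  induction n with
  | zero =>
    intro Λ _ x hxΛ y hyΛ hx hy _ v
    rw [pow_zero, mul_one]
    exact lmarginal_boxGreen_le hν hs hc hg hz hx hy hxΛ hyΛ hxΛ hyΛ v
  | succ n ih =>
    intro Λ hΛ x hxΛ y hyΛ hx hy hxy v
    set K := Λ.filter fun w => κ w = κ x with hK
    have hKΛ : K ⊆ Λ := Finset.filter_subset _ _
    have hxK : x ∈ K := Finset.mem_filter.2 ⟨hxΛ, rfl⟩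
    have hmemK : ∀ {w}, w ∈ Λ \ K → κ w ≠ κ x := fun hw h =>
      (Finset.mem_sdiff.1 hw).2 (Finset.mem_filter.2 ⟨(Finset.mem_sdiff.1 hw).1, h⟩)
    have hyK : y ∈ Λ \ K := by
      refine Finset.mem_sdiff.2 ⟨hyΛ, fun h => ?_⟩
      have := hκ.dist_le x y (Finset.mem_filter.1 h).2.symm
      rw [mul_add] at hxy
      omega
    have hΛK : IsClusterUnion κ (Λ \ K) := fun w hw w' hw' =>
      Finset.mem_sdiff.2 ⟨hΛ w (Finset.mem_sdiff.1 hw).1 w' hw', fun h =>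
        hmemK hw (hw' ▸ (Finset.mem_filter.1 h).2)⟩
    have hcard : (K.card : ℝ≥0∞) ≤ (2 * R + 1) ^ d := by
      have : K ⊆ cube R x := fun w hw =>
        mem_cube_of_l1dist_le (hκ.dist_le x w (Finset.mem_filter.1 hw).2.symm)
      have := Finset.card_le_card this
      rw [card_cube] at this
      exact_mod_cast this
    -- A single step out of the cluster, from `u` to `w`.
    have hterm : ∀ u ∈ K, ∀ w, l1dist u w = 1 → (∫⋯∫⁻_Λ, (fun v =>
        ‖boxGreen (fun w => V₀ w + g * v w) z Λ x u‖ₑ ^ s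
          * ‖boxGreen (fun w => V₀ w + g * v w) z (Λ \ K) w y‖ₑ ^ s) ∂ν) v
        ≤ k * (k * 2⁻¹ ^ n) := by
      intro u hu w huw
      by_cases hw : w ∈ Λ \ K
      · have hne : κ u ≠ κ w := fun h => hmemK hw (h ▸ (Finset.mem_filter.1 hu).2)
        have huΓ : u ∈ Γ := hκ.mem_of_ne u w huw hne
        have hwΓ : w ∈ Γ := hκ.mem_of_ne w u (l1dist_comm w u ▸ huw) hne.symm
        refine lmarginal_mul_le hKΛ (measurable_enorm_boxGreen_rpow V₀ g z Λ x u s)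
          (measurable_enorm_boxGreen_rpow V₀ g z (Λ \ K) w y s)
          (fun v => lmarginal_boxGreen_le hν hs hc hg hz hx huΓ hxΛ (hKΛ hu) hxK hu v)
          (fun v => ih (Λ \ K) hΛK w hw y hyK hwΓ hy ?_ v) (fun v v' hvv => ?_) v
        · have h1 := hκ.dist_le x u (Finset.mem_filter.1 hu).2.symm
          have h2 := l1dist_triangle x u y
          have h3 := l1dist_triangle u w y
          rw [mul_add] at hxy
          omega
        · rw [boxGreen_congr z fun w hw => by rw [hvv w (Finset.mem_sdiff.1 hw).2]]
      · have : (fun v : Site d → ℝ => ‖boxGreen (fun w => V₀ w + g * v w) z Λ x u‖ₑ ^ s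
          * ‖boxGreen (fun w => V₀ w + g * v w) z (Λ \ K) w y‖ₑ ^ s) = fun _ => 0 := by
          funext v
          rw [boxGreen_of_notMem_left hw, enorm_zero, ENNReal.zero_rpow_of_pos hs, mul_zero]
        rw [this]
        exact lmarginal_le_of_le (fun _ => zero_le) v
    have hpt : (fun v : Site d → ℝ => ‖boxGreen (fun w => V₀ w + g * v w) z Λ x y‖ₑ ^ s)
        ≤ fun v => ∑ u ∈ K, ∑ i : Fin d,
          ∑ w ∈ {u + unitVec i, u - unitVec i}, ‖boxGreen (fun w => V₀ w + g * v w) z Λ x u‖ₑ ^ s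
          * ‖boxGreen (fun w => V₀ w + g * v w) z (Λ \ K) w y‖ₑ ^ s := by
      intro v
      refine (ENNReal.rpow_le_rpow (enorm_boxGreen_le_sum_sdiff hz hKΛ hxK hyK) hs.le).trans ?_
      refine (ENNReal.rpow_sum_le_sum_rpow _ _ hs hs1).trans (Finset.sum_le_sum fun u _ => ?_)
      refine (ENNReal.rpow_sum_le_sum_rpow _ _ hs hs1).trans (Finset.sum_le_sum fun i _ => ?_)
      refine (ENNReal.rpow_add_le_add_rpow _ _ hs.le hs1).trans ?_
      rw [Finset.sum_pair, ENNReal.mul_rpow_of_nonneg _ _ hs.le,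
        ENNReal.mul_rpow_of_nonneg _ _ hs.le]
      intro h
      have h1 := congrFun h i
      simp only [unitVec, Pi.add_apply, Pi.sub_apply, Pi.single_eq_same] at h1
      omega
    have hm : ∀ u w, Measurable fun v : Site d → ℝ =>
        ‖boxGreen (fun w => V₀ w + g * v w) z Λ x u‖ₑ ^ s
          * ‖boxGreen (fun w => V₀ w + g * v w) z (Λ \ K) w y‖ₑ ^ s := fun u w =>
      (measurable_enorm_boxGreen_rpow V₀ g z Λ x u s).mul
        (measurable_enorm_boxGreen_rpow V₀ g z (Λ \ K) w y s)
    refine (lmarginal_mono hpt v).trans ?_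
    rw [lmarginal_finset_sum _ fun u _ => Finset.measurable_fun_sum _ fun i _ =>
      Finset.measurable_fun_sum _ fun w _ => hm u w]
    calc _ ≤ ∑ u ∈ K, ∑ i : Fin d, 2 * (k * (k * 2⁻¹ ^ n)) := by
          refine Finset.sum_le_sum fun u hu => ?_
          rw [lmarginal_finset_sum _ fun i _ => Finset.measurable_fun_sum _ fun w _ => hm u w]
          refine Finset.sum_le_sum fun i _ => ?_
          rw [lmarginal_finset_sum _ fun w _ => hm u w]
          refine (Finset.sum_le_card_nsmul _ _ (k * (k * 2⁻¹ ^ n)) fun w hw => ?_).trans ?_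
          · refine hterm u hu w ?_
            rcases Finset.mem_insert.1 hw with rfl | hw
            · exact l1dist_add_unitVec u i
            · rw [Finset.mem_singleton.1 hw]
              exact l1dist_sub_unitVec u i
          · rw [nsmul_eq_mul]
            gcongr
            exact_mod_cast Finset.card_le_two
      _ = (K.card * (2 * d) * k) * (k * 2⁻¹ ^ n) := by
          simp only [Finset.sum_const, nsmul_eq_mul, Finset.card_univ, Fintype.card_fin]
          ring
      _ ≤ 2⁻¹ * (k * 2⁻¹ ^ n) := by
          gcongr
          exact (mul_le_mul_left (mul_le_mul_left hcard _) _).trans hsmall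
      _ = k * 2⁻¹ ^ (n + 1) := by rw [pow_succ]; ring

end Decay

/-! ### The law of the potential in a box -/

open Classical in
/-- The distribution of the potential at the site `x`: `μ` on `Γ`, and a point mass at `0` off
`Γ`. -/
noncomputable def siteLaw {d : ℕ} (Γ : Set (Site d)) (μ : Measure ℝ) (x : Site d) : Measure ℝ :=
  if x ∈ Γ then μ else Measure.dirac 0

instance {d : ℕ} (Γ : Set (Site d)) (μ : Measure ℝ) [IsProbabilityMeasure μ] (x : Site d) :
    IsProbabilityMeasure (siteLaw Γ μ x) := by
  unfold siteLaw
  split_ifs <;> infer_instance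

section Law

variable {Ω : Type*} [MeasurableSpace Ω] {P : Measure Ω} {d : ℕ} {Γ : Set (Site d)} {μ : Measure ℝ}
  {V : Ω → Site d → ℝ}

lemma IsTrimmedRandomPotential.measurable_apply (hV : IsTrimmedRandomPotential P Γ μ V)
    (x : Site d) : Measurable fun ω => V ω x := by
  by_cases hx : x ∈ Γ
  · exact hV.measurable x hx
  · simp only [hV.eq_zero _ x hx]
    exact measurable_const

open Classical in
lemma IsTrimmedRandomPotential.map_restrict [IsProbabilityMeasure P] [IsProbabilityMeasure μ]
    (hV : IsTrimmedRandomPotential P Γ μ V)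
    (Λ : Finset (Site d)) :
    P.map (fun ω (i : Λ) => V ω i) = Measure.pi fun i : Λ => siteLaw Γ μ i := by
  symm
  refine Measure.pi_eq fun A hA => ?_
  set B : Site d → Set ℝ := fun x => if h : x ∈ Λ then A ⟨x, h⟩ else Set.univ with hB
  have hBA : ∀ i : Λ, A i = B i := fun i => by simp [hB]
  have hBm : ∀ x, MeasurableSet (B x) := fun x => by
    simp only [hB]
    split_ifs with h
    · exact hA ⟨x, h⟩
    · exact MeasurableSet.univ
  have hVm : Measurable fun ω (i : Λ) => V ω i :=
    measurable_pi_lambda _ fun i => hV.measurable_apply i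
  rw [Measure.map_apply hVm (MeasurableSet.univ_pi hA)]
  have hpre : (fun ω (i : Λ) => V ω i) ⁻¹' Set.univ.pi A = {ω | ∀ x ∈ Λ, V ω x ∈ B x} := by
    ext ω
    simp only [Set.mem_preimage, Set.mem_univ_pi, Set.mem_ofPred_eq, Subtype.forall]
    exact forall₂_congr fun x hx => by rw [hBA ⟨x, hx⟩]
  rw [hpre, Finset.prod_congr rfl fun i _ => by rw [hBA i],
    Finset.prod_coe_sort Λ fun x => siteLaw Γ μ x (B x)]
  by_cases h0 : ∃ x ∈ Λ, x ∉ Γ ∧ (0 : ℝ) ∉ B x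
  · obtain ⟨x, hx, hxΓ, hxB⟩ := h0
    rw [Finset.prod_eq_zero hx]
    · refine measure_mono_null (fun ω hω => ?_) measure_empty
      have := hω x hx
      rw [hV.eq_zero ω x hxΓ] at this
      exact absurd this hxB
    · rw [siteLaw, if_neg hxΓ, Measure.dirac_apply' _ (hBm x), Set.indicator_of_notMem hxB]
  · push Not at h0
    have h1 := (iIndepFun_iff_measure_inter_preimage_eq_mul.1 hV.indep) (Λ.subtype (· ∈ Γ))
      (sets := fun x => B x) fun x _ => hBm x
    have h2 : {ω | ∀ x ∈ Λ, V ω x ∈ B x}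
        = ⋂ i ∈ Λ.subtype (· ∈ Γ), (fun ω => V ω i) ⁻¹' B i := by
      ext ω
      simp only [Set.mem_ofPred_eq, Set.mem_iInter, Finset.mem_subtype, Set.mem_preimage]
      refine ⟨fun h i hi => h i hi, fun h x hx => ?_⟩
      by_cases hxΓ : x ∈ Γ
      · exact h ⟨x, hxΓ⟩ hx
      · rw [hV.eq_zero ω x hxΓ]
        exact h0 x hx hxΓ
    have h3 : ∀ i ∈ Λ.subtype (· ∈ Γ), P ((fun ω => V ω i) ⁻¹' B i) = siteLaw Γ μ i (B i) := by
      intro i _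
      rw [siteLaw, if_pos i.2, ← hV.law i i.2, Measure.map_apply (hV.measurable i i.2) (hBm i)]
    rw [h2, h1, Finset.prod_congr rfl h3,
      Finset.prod_subtype_eq_prod_filter (fun x => siteLaw Γ μ x (B x)), Finset.prod_filter_of_ne]
    intro x hx hne
    by_contra hxΓ
    refine hne ?_
    rw [siteLaw, if_neg hxΓ, Measure.dirac_apply' _ (hBm x), Set.indicator_of_mem (h0 x hx hxΓ),
      Pi.one_apply]

/-- The expectation of a function of the potential in the box is a marginal integral over the
box. -/
lemma IsTrimmedRandomPotential.lintegral_eq_lmarginal [IsProbabilityMeasure P]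
    [IsProbabilityMeasure μ] (hV : IsTrimmedRandomPotential P Γ μ V)
    (Λ : Finset (Site d)) {f : (Site d → ℝ) → ℝ≥0∞} (hf : Measurable f)
    (hdep : ∀ v w, (∀ i ∈ Λ, v i = w i) → f v = f w) (v : Site d → ℝ) :
    ∫⁻ ω, f (V ω) ∂P = (∫⋯∫⁻_Λ, f ∂(siteLaw Γ μ)) v := by
  have hf' : Measurable fun y : Λ → ℝ => f (Function.updateFinset v Λ y) :=
    hf.comp measurable_updateFinset
  unfold lmarginal
  rw [← hV.map_restrict Λ,
    lintegral_map hf' (measurable_pi_lambda _ fun i => hV.measurable_apply i)]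
  refine lintegral_congr fun ω => hdep _ _ fun i hi => ?_
  simp [Function.updateFinset, hi]

end Law

/-! ### Large imaginary part -/

section LargeIm

variable {d : ℕ} {U : Site d → ℝ} {z : ℂ}

/-- Far from the real axis the Green function decays exponentially for every potential. -/
lemma enorm_boxGreen_le_half_pow (hd : 1 ≤ d) (hz : 4 * (d : ℝ) ≤ z.im) (n : ℕ) :
    ∀ (Λ : Finset (Site d)) (x y : Site d), n ≤ l1dist x y → ‖boxGreen U z Λ x y‖ₑ ≤ 2⁻¹ ^ n := by
  have hd' : (1 : ℝ) ≤ d := by exact_mod_cast hd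
  have hz0 : 0 < z.im := by linarith
  have hbound : ∀ (Λ : Finset (Site d)) (x y : Site d),
      ‖boxGreen U z Λ x y‖ₑ ≤ (4 * d : ℝ≥0∞)⁻¹ := by
    intro Λ x y
    have h1 := (norm_boxGreen_le (U := U) (Λ := Λ) hz0 x y).trans
      (one_div_le_one_div_of_le (by positivity) hz)
    rw [← ofReal_norm]
    refine (ENNReal.ofReal_le_ofReal h1).trans (le_of_eq ?_)
    rw [one_div, ENNReal.ofReal_inv_of_pos (by positivity), ENNReal.ofReal_mul (by norm_num)]
    simp
  have hd0 : (d : ℝ≥0∞) ≠ 0 := by exact_mod_cast (by omega : d ≠ 0)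
  induction n with
  | zero =>
    intro Λ x y _
    refine (hbound Λ x y).trans ?_
    rw [pow_zero, ENNReal.inv_le_one]
    exact_mod_cast (by omega : 1 ≤ 4 * d)
  | succ n ih =>
    intro Λ x y hxy
    by_cases hmem : x ∈ Λ ∧ y ∈ Λ
    swap
    · rw [boxGreen, dif_neg hmem, enorm_zero]
      exact zero_le
    have hne : y ≠ x := fun h => by rw [h, l1dist_self] at hxy; omega
    refine (enorm_boxGreen_le_sum_sdiff hz0 (Finset.singleton_subset_iff.2 hmem.1)
      (Finset.mem_singleton_self x) (Finset.mem_sdiff.2 ⟨hmem.2, by simpa using hne⟩)).trans ?_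
    rw [Finset.sum_singleton]
    have hw : ∀ w, l1dist x w = 1 → ‖boxGreen U z Λ x x‖ₑ * ‖boxGreen U z (Λ \ {x}) w y‖ₑ
        ≤ (4 * d : ℝ≥0∞)⁻¹ * 2⁻¹ ^ n := fun w hw =>
      mul_le_mul' (hbound _ _ _) (ih _ _ _ (by have := l1dist_triangle x w y; omega))
    refine (Finset.sum_le_sum fun i _ => add_le_add (hw _ (l1dist_add_unitVec x i))
      (hw _ (l1dist_sub_unitVec x i))).trans (le_of_eq ?_)
    rw [Finset.sum_const, Finset.card_univ, Fintype.card_fin, nsmul_eq_mul, ← two_mul, pow_succ,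
      ENNReal.mul_inv (by norm_num) (by norm_num)]
    have h4 : (4 : ℝ≥0∞)⁻¹ = 2⁻¹ * 2⁻¹ := by
      rw [← ENNReal.mul_inv (by norm_num) (by norm_num)]; norm_num
    rw [h4]
    calc _ = (d * (d : ℝ≥0∞)⁻¹) * (2 * 2⁻¹) * (2⁻¹ ^ n * 2⁻¹) := by ring
      _ = _ := by
        rw [ENNReal.mul_inv_cancel hd0 (by simp), ENNReal.mul_inv_cancel (by simp) (by simp),
          one_mul, one_mul]

end LargeIm

/-! ### The infinite volume limit -/

section Limit

variable {d : ℕ} {U : Site d → ℝ} {z : ℂ}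

lemma green_eq_resolventMap_apply (U : Site d → ℝ) (z : ℂ) (x y : Site d) :
    green U z x y = resolventMap U z (lp.single 2 y (1 : ℂ)) x := by
  rw [green, lp.inner_single_left]
  simp

lemma green_equation (hz : z.im ≠ 0) (x y : Site d) :
    ((2 * d : ℂ) + U x - z) * green U z x y
      - ∑ i : Fin d, (green U z (x + unitVec i) y + green U z (x - unitVec i) y)
      = if x = y then 1 else 0 := by
  simp only [green_eq_resolventMap_apply]
  have hex := schrodinger_existsUnique U hz (lp.single 2 y (1 : ℂ))
  have hφ : resolventMap U z (lp.single 2 y (1 : ℂ)) = (hex.choose : EllTwo d) := by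
    rw [resolventMap, dif_pos hex]
  rw [hφ]
  have h := congrArg (fun f : EllTwo d => f x) hex.choose_spec.1
  simp only [lp.coeFn_sub, lp.coeFn_smul, Pi.sub_apply, Pi.smul_apply, smul_eq_mul,
    schrodinger_apply, schrodingerMap, LinearMap.coe_mk, AddHom.coe_mk, lp.coeFn_single,
    Pi.single_apply] at h
  rw [← h]
  simp only [Finset.sum_add_distrib, Finset.sum_sub_distrib, Finset.sum_const, Finset.card_univ,
    Fintype.card_fin, nsmul_eq_mul]
  ring

lemma summable_normSq_green (U : Site d → ℝ) (z : ℂ) (y : Site d) :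
    Summable fun x => ‖green U z x y‖ ^ 2 := by
  simp only [green_eq_resolventMap_apply]
  simpa using (lp.memℓp (resolventMap U z (lp.single 2 y (1 : ℂ)))).summable (by norm_num)

/-- The box Green functions converge to the Green function: cutting the column of the latter to
the box produces an error supported on the boundary bonds, whose `ℓ²` norm tends to `0`. -/
lemma tendsto_boxGreen (hz : 0 < z.im) (x y : Site d) :
    Filter.Tendsto (fun Λ => boxGreen U z Λ x y) Filter.atTop (nhds (green U z x y)) := by
  set φ : Site d → ℂ := fun w => green U z w y with hφ
  set τ : Finset (Site d) → ℝ := fun Λ => ∑' v : {v // v ∉ Λ}, ‖φ v‖ ^ 2 with hτ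
  have hτ0 : Filter.Tendsto τ Filter.atTop (nhds 0) :=
    tendsto_tsum_compl_atTop_zero fun v => ‖φ v‖ ^ 2
  have hsum := summable_normSq_green U z y
  have hmain : ∀ Λ : Finset (Site d), x ∈ Λ →
      ‖boxGreen U z Λ x y - green U z x y‖ ≤ ∑ i : Fin d, 2 * (1 / z.im * √(τ Λ)) := by
    intro Λ hx
    set χ : Site d → ℂ := fun w => if w ∈ Λ then 0 else φ w with hχ
    have heq : ∀ w ∈ Λ, ∑ v ∈ Λ, schrodingerKernel U z w v * (φ v - χ v)
        = (if w = y then 1 else 0) + ∑ i : Fin d, (χ (w + unitVec i) + χ (w - unitVec i)) := by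
      intro w hw
      rw [sum_schrodingerKernel_mul w (fun v => φ v - χ v) fun v hv => by simp [hχ, hv],
        ← green_equation (U := U) hz.ne' w y]
      have : χ w = 0 := by simp [hχ, hw]
      rw [this, sub_zero]
      simp only [hφ, Finset.sum_add_distrib, Finset.sum_sub_distrib]
      ring
    have h1 := eq_sum_boxGreen_mul hz heq hx
    have hχx : χ x = 0 := by simp [hχ, hx]
    have hδ : ∑ w ∈ Λ, boxGreen U z Λ x w * (if w = y then 1 else 0) = boxGreen U z Λ x y := by
      simp only [mul_ite, mul_one, mul_zero, Finset.sum_ite_eq']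
      split_ifs with h
      · rfl
      · rw [boxGreen_of_notMem_right x h]
    simp only [mul_add, Finset.sum_add_distrib] at h1
    rw [hδ, hχx, sub_zero] at h1
    have hshift : ∀ a : Site d, ‖∑ w ∈ Λ, boxGreen U z Λ x w * χ (w + a)‖
        ≤ 1 / z.im * √(τ Λ) := by
      intro a
      have hχτ : ∑ w ∈ Λ, ‖χ (w + a)‖ ^ 2 ≤ τ Λ := by
        have hs : Summable fun v => ‖χ v‖ ^ 2 := by
          refine Summable.of_nonneg_of_le (fun _ => by positivity) (fun v => ?_) hsum
          simp only [hχ]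
          split_ifs
          · simp
          · exact le_rfl
        have ht : τ Λ = ∑' v, ‖χ v‖ ^ 2 := by
          rw [hτ]
          simp only
          rw [← tsum_subtype_eq_of_support_subset (s := {v | v ∉ Λ})]
          · refine tsum_congr fun v => ?_
            simp only [hχ]
            rw [if_neg v.2]
          · intro v hv hv'
            simp [hχ, hv'] at hv
        rw [ht, ← (Equiv.addRight a).tsum_eq]
        exact Summable.sum_le_tsum _ (fun _ _ => by positivity) (hs.comp_injective
          (add_left_injective a))
      refine (norm_sum_le _ _).trans ?_
      simp only [norm_mul]
      refine (Real.sum_mul_le_sqrt_mul_sqrt _ _ _).trans ?_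
      gcongr
      exact Real.sqrt_le_iff.2 ⟨by positivity, sum_normSq_boxGreen_le hz x⟩
    rw [show green U z x y = φ x from rfl, h1, sub_add_cancel_left, norm_neg]
    simp only [Finset.mul_sum]
    rw [Finset.sum_comm' (t' := Finset.univ) (s' := fun _ => Λ) (by simp),
      Finset.sum_comm' (s := Λ) (t' := Finset.univ) (s' := fun _ => Λ) (by simp),
      ← Finset.sum_add_distrib]
    refine (norm_sum_le _ _).trans (Finset.sum_le_sum fun i _ => ?_)
    rw [two_mul]
    refine (norm_add_le _ _).trans (add_le_add (hshift _) ?_)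
    simpa only [sub_eq_add_neg] using hshift (-unitVec i)
  rw [tendsto_iff_norm_sub_tendsto_zero]
  have hlim : Filter.Tendsto (fun Λ => ∑ i : Fin d, 2 * (1 / z.im * √(τ Λ))) Filter.atTop
      (nhds 0) := by
    have h := tendsto_finsetSum (Finset.univ : Finset (Fin d)) fun i _ =>
      ((hτ0.sqrt).const_mul (1 / z.im)).const_mul 2
    simpa using h
  refine squeeze_zero' (Filter.Eventually.of_forall fun _ => norm_nonneg _) ?_ hlim
  filter_upwards [Filter.eventually_ge_atTop {x}] with Λ hΛ
  exact hmain Λ (hΛ (Finset.mem_singleton_self x))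

end Limit

/-! ### Propagation of the decay to the sites without randomness -/

/-- Uniform exponential decay, with rate `η`, of the `t`-th moments of the box Green functions
between sites of `A` and sites of `B`, for all boxes that are unions of clusters and all `z` in the
upper half plane with `‖z‖ ≤ Z`. -/
def HasBoxDecay {Ω : Type*} [MeasurableSpace Ω] (P : Measure Ω) {d : ℕ} {T : Type*}
    (U : Ω → Site d → ℝ) (κ : Site d → T) (Z : ℝ) (A B : Set (Site d)) (t η : ℝ) : Prop :=
  ∃ C : ℝ≥0∞, C ≠ ∞ ∧ ∀ Λ : Finset (Site d), IsClusterUnion κ Λ → ∀ z : ℂ, 0 < z.im → ‖z‖ ≤ Z →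
    ∀ x ∈ Λ, x ∈ A → ∀ y ∈ Λ, y ∈ B →
      ∫⁻ ω, ‖boxGreen (U ω) z Λ x y‖ₑ ^ t ∂P ≤ C * ENNReal.ofReal (Real.exp (-(η * l1dist x y)))

section Propagation

variable {Ω : Type*} [MeasurableSpace Ω] {P : Measure Ω} {d : ℕ} {T : Type*}
  {U : Ω → Site d → ℝ} {κ : Site d → T} {Z : ℝ} {A B : Set (Site d)} {t η : ℝ}

lemma HasBoxDecay.symm (h : HasBoxDecay P U κ Z A B t η) : HasBoxDecay P U κ Z B A t η := by
  obtain ⟨C, hC, h⟩ := h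
  refine ⟨C, hC, fun Λ hΛ z hz hzZ x hx hxB y hy hyA => ?_⟩
  simp_rw [fun ω => boxGreen_comm (U ω) z Λ x y]
  rw [l1dist_comm]
  exact h Λ hΛ z hz hzZ y hy hyA x hx hxB

lemma lintegral_rpow_half_mul_le {f h : Ω → ℝ≥0∞} (hf : Measurable f) (hh : Measurable h) (t : ℝ) :
    ∫⁻ ω, f ω ^ (t / 2) * h ω ^ (t / 2) ∂P
      ≤ (∫⁻ ω, f ω ^ t ∂P) ^ (1 / 2 : ℝ) * (∫⁻ ω, h ω ^ t ∂P) ^ (1 / 2 : ℝ) := by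
  have := ENNReal.lintegral_mul_le_Lp_mul_Lq P Real.HolderConjugate.two_two
    (hf.pow_const (t / 2)).aemeasurable (hh.pow_const (t / 2)).aemeasurable
  simpa only [Pi.mul_apply, ← ENNReal.rpow_mul, div_mul_cancel₀ t (two_ne_zero' ℝ)] using this

lemma lintegral_rpow_half_le [IsProbabilityMeasure P] {f : Ω → ℝ≥0∞} (hf : Measurable f) (t : ℝ) :
    ∫⁻ ω, f ω ^ (t / 2) ∂P ≤ (∫⁻ ω, f ω ^ t ∂P) ^ (1 / 2 : ℝ) := by
  simpa using lintegral_rpow_half_mul_le (P := P) hf (measurable_const (a := (1 : ℝ≥0∞))) t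

lemma exp_rpow_half_le {η : ℝ} (hη : 0 < η) {m n : ℕ} (hmn : m ≤ n + 2) (C : ℝ≥0∞) :
    (C * ENNReal.ofReal (Real.exp (-(η * n)))) ^ (1 / 2 : ℝ)
      ≤ C ^ (1 / 2 : ℝ) * (ENNReal.ofReal (Real.exp η)
        * ENNReal.ofReal (Real.exp (-(η / 2 * m)))) := by
  rw [ENNReal.mul_rpow_of_nonneg _ _ (by norm_num), ENNReal.ofReal_rpow_of_pos (Real.exp_pos _),
    ← Real.exp_mul, ← ENNReal.ofReal_mul (Real.exp_pos _).le, ← Real.exp_add]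
  gcongr
  have : (m : ℝ) ≤ n + 2 := by exact_mod_cast hmn
  nlinarith

/-- One step of unique continuation: the equation at `x + e₁` expresses the Green function at `x`
through its values at sites with larger first coordinate. -/
lemma enorm_boxGreen_le_shift {W : Site d → ℝ} {z : ℂ} {Λ : Finset (Site d)} (hz : 0 < z.im)
    (i₀ : Fin d) {x y : Site d} (hx : x + unitVec i₀ ∈ Λ) :
    ‖boxGreen W z Λ x y‖ₑ ≤
      ‖(2 * d : ℂ) + W (x + unitVec i₀) - z‖ₑ * ‖boxGreen W z Λ (x + unitVec i₀) y‖ₑ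
      + ((if x + unitVec i₀ = y then 1 else 0)
        + (‖boxGreen W z Λ (x + unitVec i₀ + unitVec i₀) y‖ₑ + ∑ i ∈ Finset.univ.erase i₀,
          (‖boxGreen W z Λ (x + unitVec i₀ + unitVec i) y‖ₑ
            + ‖boxGreen W z Λ (x + unitVec i₀ - unitVec i) y‖ₑ))) := by
  have h := sum_schrodingerKernel_mul_boxGreen (U := W) hz hx y
  rw [sum_schrodingerKernel_mul _ _ fun w hw => boxGreen_of_notMem_left hw y,
    ← Finset.add_sum_erase _ _ (Finset.mem_univ i₀), add_sub_cancel_right] at h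
  have hsolve : boxGreen W z Λ x y
      = ((2 * d : ℂ) + W (x + unitVec i₀) - z) * boxGreen W z Λ (x + unitVec i₀) y
      - ((if x + unitVec i₀ = y then 1 else 0)
        + (boxGreen W z Λ (x + unitVec i₀ + unitVec i₀) y + ∑ i ∈ Finset.univ.erase i₀,
          (boxGreen W z Λ (x + unitVec i₀ + unitVec i) y
            + boxGreen W z Λ (x + unitVec i₀ - unitVec i) y))) := by
    rw [← h]; ring
  rw [hsolve]
  refine enorm_sub_le.trans (add_le_add (enorm_mul _ _).le ?_)
  refine (enorm_add_le _ _).trans (add_le_add ?_ ?_)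
  · split_ifs <;> simp
  · refine (enorm_add_le _ _).trans (add_le_add le_rfl ?_)
    exact (enorm_sum_le _ _).trans (Finset.sum_le_sum fun i _ => enorm_add_le _ _)

/-- The sites of `Γ`, together with the sites `x` above which the part of the cluster of `x`
outside `Γ` extends by less than `k` in direction `i₀`. -/
def sitesOfHeight (Γ : Set (Site d)) (κ : Site d → T) (i₀ : Fin d) (k : ℕ) : Set (Site d) :=
  {x | x ∈ Γ ∨ ∀ w ∉ Γ, κ w = κ x → w i₀ < x i₀ + k}

lemma IsClusterMap.shift_mem_sitesOfHeight {Γ : Set (Site d)} {R : ℕ} (hκ : IsClusterMap Γ κ R)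
    {i₀ : Fin d} {k : ℕ} {x : Site d} (hx : x ∈ sitesOfHeight Γ κ i₀ (k + 1)) (hxΓ : x ∉ Γ) :
    κ (x + unitVec i₀) = κ x ∧ ∀ w, (w = x + unitVec i₀ ∨ l1dist w (x + unitVec i₀) = 1) →
      x i₀ + 1 ≤ w i₀ → w ∈ sitesOfHeight Γ κ i₀ k := by
  have h1 : κ (x + unitVec i₀) = κ x := by
    by_contra h
    exact hxΓ (hκ.mem_of_ne x _ (l1dist_add_unitVec x i₀) (Ne.symm h))
  refine ⟨h1, fun w hw hle => ?_⟩
  by_cases hwΓ : w ∈ Γ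
  · exact Or.inl hwΓ
  have h2 : κ w = κ x := by
    rcases hw with rfl | hw
    · exact h1
    · rw [← h1]
      by_contra h
      exact hwΓ (hκ.mem_of_ne w _ hw h)
  refine Or.inr fun v hv hvw => ?_
  have := hx.resolve_left hxΓ v hv (hvw.trans h2)
  push_cast at this
  omega

/-- One step of the propagation: by the Cauchy–Schwarz inequality, multiplication by the potential
costs a factor two in the exponent and in the rate. -/
lemma HasBoxDecay.step [IsProbabilityMeasure P] (hU : Measurable U) {Γ : Set (Site d)} {R : ℕ}
    (hκ : IsClusterMap Γ κ R) (i₀ : Fin d) (ht : 0 < t) (ht1 : t ≤ 1) (hη : 0 < η) {M : ℝ≥0∞}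
    (hM : M ≠ ∞)
    (hmom : ∀ z : ℂ, ‖z‖ ≤ Z → ∀ x, ∫⁻ ω, ‖(2 * d : ℂ) + U ω x - z‖ₑ ^ t ∂P ≤ M) {k : ℕ}
    (h : HasBoxDecay P U κ Z (sitesOfHeight Γ κ i₀ k) B t η) :
    HasBoxDecay P U κ Z (sitesOfHeight Γ κ i₀ (k + 1)) B (t / 2) (η / 2) := by
  obtain ⟨C, hC, h⟩ := h
  set E := ENNReal.ofReal (Real.exp η) with hE
  have hmG : ∀ (z : ℂ) (Λ : Finset (Site d)) (x y : Site d),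
      Measurable fun ω => ‖boxGreen (U ω) z Λ x y‖ₑ := fun z Λ x y =>
    ((measurable_boxGreen z Λ x y).comp hU).enorm
  -- The decay at the sites `w` where it is already known, written in terms of a nearby site `x`.
  have hold : ∀ Λ : Finset (Site d), IsClusterUnion κ Λ → ∀ z : ℂ, 0 < z.im → ‖z‖ ≤ Z →
      ∀ x w, l1dist x w ≤ 2 → w ∈ sitesOfHeight Γ κ i₀ k → ∀ y ∈ Λ, y ∈ B →
      ∫⁻ ω, ‖boxGreen (U ω) z Λ w y‖ₑ ^ (t / 2) ∂P
        ≤ C ^ (1 / 2 : ℝ) * (E * ENNReal.ofReal (Real.exp (-(η / 2 * l1dist x y)))) := by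
    intro Λ hΛ z hz hzZ x w hxw hw y hy hyB
    by_cases hwΛ : w ∈ Λ
    · refine (lintegral_rpow_half_le (hmG z Λ w y) t).trans
        ((ENNReal.rpow_le_rpow (h Λ hΛ z hz hzZ w hwΛ hw y hy hyB) (by norm_num)).trans ?_)
      refine exp_rpow_half_le hη ?_ C
      have := l1dist_triangle x w y
      omega
    · simp [boxGreen_of_notMem_left hwΛ, ENNReal.zero_rpow_of_pos (half_pos ht)]
  have hC2 : C ^ (1 / 2 : ℝ) ≠ ∞ := ENNReal.rpow_ne_top_of_nonneg (by norm_num) hC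
  have hM2 : M ^ (1 / 2 : ℝ) ≠ ∞ := ENNReal.rpow_ne_top_of_nonneg (by norm_num) hM
  refine ⟨(M ^ (1 / 2 : ℝ) * C ^ (1 / 2 : ℝ) + (1 + (C ^ (1 / 2 : ℝ)
      + ∑ _i ∈ Finset.univ.erase i₀, (C ^ (1 / 2 : ℝ) + C ^ (1 / 2 : ℝ)))) + C ^ (1 / 2 : ℝ)) * E,
    ?_, fun Λ hΛ z hz hzZ x hxΛ hx y hy hyB => ?_⟩
  · refine ENNReal.mul_ne_top (ENNReal.add_ne_top.2 ⟨ENNReal.add_ne_top.2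
      ⟨ENNReal.mul_ne_top hM2 hC2, ENNReal.add_ne_top.2 ⟨ENNReal.one_ne_top,
        ENNReal.add_ne_top.2 ⟨hC2, ?_⟩⟩⟩, hC2⟩) ENNReal.ofReal_ne_top
    exact ENNReal.sum_ne_top.2 fun _ _ => ENNReal.add_ne_top.2 ⟨hC2, hC2⟩
  rw [mul_assoc]
  set D := E * ENNReal.ofReal (Real.exp (-(η / 2 * l1dist x y))) with hD
  by_cases hxΓ : x ∈ Γ
  · refine (hold Λ hΛ z hz hzZ x x (by rw [l1dist_self]; omega) (Or.inl hxΓ) y hy hyB).trans ?_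
    gcongr
    exact le_add_self
  obtain ⟨h1, h2⟩ := hκ.shift_mem_sitesOfHeight hx hxΓ
  have hx1 : x + unitVec i₀ ∈ Λ := hΛ x hxΛ _ h1
  have hxx : l1dist x (x + unitVec i₀) = 1 := l1dist_add_unitVec x i₀
  have ht2 : 0 < t / 2 := half_pos ht
  have ht2' : t / 2 ≤ 1 := by linarith
  have hpt : ∀ ω, ‖boxGreen (U ω) z Λ x y‖ₑ ^ (t / 2) ≤
      ‖(2 * d : ℂ) + U ω (x + unitVec i₀) - z‖ₑ ^ (t / 2)
          * ‖boxGreen (U ω) z Λ (x + unitVec i₀) y‖ₑ ^ (t / 2)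
      + ((if x + unitVec i₀ = y then 1 else 0)
        + (‖boxGreen (U ω) z Λ (x + unitVec i₀ + unitVec i₀) y‖ₑ ^ (t / 2)
          + ∑ i ∈ Finset.univ.erase i₀,
          (‖boxGreen (U ω) z Λ (x + unitVec i₀ + unitVec i) y‖ₑ ^ (t / 2)
            + ‖boxGreen (U ω) z Λ (x + unitVec i₀ - unitVec i) y‖ₑ ^ (t / 2)))) := by
    intro ω
    have hsub := fun a b : ℝ≥0∞ => ENNReal.rpow_add_le_add_rpow a b ht2.le ht2'
    refine (ENNReal.rpow_le_rpow (enorm_boxGreen_le_shift hz i₀ hx1) ht2.le).trans ?_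
    refine (hsub _ _).trans (add_le_add (ENNReal.mul_rpow_of_nonneg _ _ ht2.le).le ?_)
    refine (hsub _ _).trans (add_le_add ?_ ?_)
    · split_ifs
      · rw [ENNReal.one_rpow]
      · rw [ENNReal.zero_rpow_of_pos ht2]
    refine (hsub _ _).trans (add_le_add le_rfl ?_)
    refine (ENNReal.rpow_sum_le_sum_rpow _ _ ht2 ht2').trans ?_
    exact Finset.sum_le_sum fun i _ => hsub _ _
  have hm : ∀ w, Measurable fun ω => ‖boxGreen (U ω) z Λ w y‖ₑ ^ (t / 2) := fun w =>
    (hmG z Λ w y).pow_const _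
  have hUx : Measurable fun ω => ‖(2 * d : ℂ) + U ω (x + unitVec i₀) - z‖ₑ := by
    have : Measurable fun ω => U ω (x + unitVec i₀) := (measurable_pi_apply _).comp hU
    fun_prop
  refine (lintegral_mono hpt).trans ?_
  rw [lintegral_add_left ((hUx.pow_const _).fun_mul (hm _)), lintegral_add_left measurable_const,
    lintegral_add_left (hm _), lintegral_finsetSum _ fun i _ => (hm _).fun_add (hm _)]
  have hw : ∀ w, (w = x + unitVec i₀ ∨ l1dist w (x + unitVec i₀) = 1) → x i₀ + 1 ≤ w i₀ →
      ∫⁻ ω, ‖boxGreen (U ω) z Λ w y‖ₑ ^ (t / 2) ∂P ≤ C ^ (1 / 2 : ℝ) * D := by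
    intro w hw hle
    refine hold Λ hΛ z hz hzZ x w ?_ (h2 w hw hle) y hy hyB
    have h3 := l1dist_triangle x (x + unitVec i₀) w
    rcases hw with rfl | hw
    · omega
    · rw [l1dist_comm] at hw
      omega
  refine le_trans ?_ (mul_le_mul_left le_self_add D)
  rw [add_mul, add_mul, one_mul, add_mul, Finset.sum_mul]
  gcongr with i hi
  · refine (lintegral_rpow_half_mul_le hUx (hmG z Λ _ y) t).trans ?_
    rw [mul_assoc]
    refine mul_le_mul' (ENNReal.rpow_le_rpow (hmom z hzZ _) (by norm_num)) ?_
    refine (ENNReal.rpow_le_rpow (h Λ hΛ z hz hzZ _ hx1 (h2 _ (Or.inl rfl) ?_) y hy hyB)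
      (by norm_num)).trans (exp_rpow_half_le hη ?_ C)
    · simp [unitVec]
    · have := l1dist_triangle x (x + unitVec i₀) y
      omega
  · rw [lintegral_const, measure_univ, mul_one]
    split_ifs with hxy
    · rw [hD, ← hxy, hxx, hE, ← ENNReal.ofReal_mul (Real.exp_pos _).le, ← Real.exp_add,
        ENNReal.one_le_ofReal]
      refine Real.one_le_exp ?_
      push_cast
      linarith
    · exact zero_le
  · refine hw _ (Or.inr ?_) ?_
    · rw [l1dist_comm]; exact l1dist_add_unitVec _ _
    · simp [unitVec]
  · have hne : i₀ ≠ i := (Finset.ne_of_mem_erase hi).symm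
    rw [lintegral_add_left (hm _), add_mul]
    refine add_le_add (hw _ (Or.inr ?_) ?_) (hw _ (Or.inr ?_) ?_)
    · rw [l1dist_comm]; exact l1dist_add_unitVec _ _
    · simp [unitVec, hne]
    · rw [l1dist_comm]; exact l1dist_sub_unitVec _ _
    · simp [unitVec, hne]

/-- Decay on `Γ` in the first variable implies decay everywhere, because `R + 1` steps in the first
direction leave every cluster. -/
lemma HasBoxDecay.propagate [IsProbabilityMeasure P] (hU : Measurable U) {Γ : Set (Site d)} {R : ℕ}
    (hκ : IsClusterMap Γ κ R) (hd : 1 ≤ d) (ht : 0 < t) (ht1 : t ≤ 1) (hη : 0 < η)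
    (hmom : ∀ t' : ℝ, 0 < t' → t' ≤ t → ∃ M : ℝ≥0∞, M ≠ ∞ ∧ ∀ z : ℂ, ‖z‖ ≤ Z → ∀ x,
      ∫⁻ ω, ‖(2 * d : ℂ) + U ω x - z‖ₑ ^ t' ∂P ≤ M)
    (h : HasBoxDecay P U κ Z Γ B t η) :
    HasBoxDecay P U κ Z Set.univ B (t / 2 ^ (R + 1)) (η / 2 ^ (R + 1)) := by
  set i₀ : Fin d := ⟨0, hd⟩
  have hk : ∀ k : ℕ, HasBoxDecay P U κ Z (sitesOfHeight Γ κ i₀ k) B (t / 2 ^ k) (η / 2 ^ k) := by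
    intro k
    induction k with
    | zero =>
      have : sitesOfHeight Γ κ i₀ 0 = Γ := by
        ext x
        refine ⟨fun hx => ?_, Or.inl⟩
        by_contra hxΓ
        simpa using hx.resolve_left hxΓ x hxΓ rfl
      simpa [this] using h
    | succ k ih =>
      have htk : t / 2 ^ k ≤ t := div_le_self ht.le (one_le_pow₀ one_le_two)
      obtain ⟨M, hM, hmom⟩ := hmom (t / 2 ^ k) (by positivity) htk
      have := ih.step hU hκ i₀ (by positivity) (htk.trans ht1) (by positivity) hM hmom
      simpa only [pow_succ, ← div_div] using this
  have huniv : sitesOfHeight Γ κ i₀ (R + 1) = Set.univ := by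
    refine Set.eq_univ_of_forall fun x => Or.inr fun w _ hw => ?_
    have := (natAbs_sub_le_l1dist w x i₀).trans (hκ.dist_le w x hw)
    push_cast
    omega
  rw [← huniv]
  exact hk _

end Propagation

/-! ### Clusters -/

section Clusters

variable {d : ℕ} {Γ : Set (Site d)} {V₀ : Site d → ℝ}

lemma IsCofinitelyInvariant.exists_forall_abs_le (h : IsCofinitelyInvariant Γ V₀) :
    ∃ v : ℝ, ∀ x, |V₀ x| ≤ v := by
  obtain ⟨𝒢, h𝒢, h⟩ := h
  have := Fintype.ofFinite (Site d ⧸ 𝒢)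
  refine ⟨∑ q : Site d ⧸ 𝒢, |V₀ q.out|, fun x => ?_⟩
  obtain ⟨a, ha⟩ := QuotientAddGroup.mk_out_eq_add 𝒢 x
  rw [← (h a a.2 x).2, ← ha]
  exact Finset.single_le_sum (f := fun q : Site d ⧸ 𝒢 => |V₀ q.out|) (fun _ _ => abs_nonneg _)
    (Finset.mem_univ _)

/-- By periodicity the diameters of the components of `Γᶜ` are bounded. -/
lemma IsCofinitelyInvariant.exists_l1dist_le (h : IsCofinitelyInvariant Γ V₀)
    (hΓ : IsDoublyInsulated Γ) :
    ∃ D : ℕ, ∀ x w : (Γᶜ : Set (Site d)), ((latticeGraph d).induce Γᶜ).Reachable x w →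
      l1dist (x : Site d) w ≤ D := by
  obtain ⟨𝒢, h𝒢, h⟩ := h
  have := Fintype.ofFinite (Site d ⧸ 𝒢)
  have hfin : ∀ x : Site d, ∃ n : ℕ, ∀ (hx : x ∈ Γᶜ) (w : (Γᶜ : Set (Site d))),
      ((latticeGraph d).induce Γᶜ).Reachable ⟨x, hx⟩ w → l1dist x w ≤ n := by
    intro x
    by_cases hx : x ∈ Γᶜ
    · obtain ⟨n, hn⟩ := ((hΓ.1 (((latticeGraph d).induce Γᶜ).connectedComponentMk ⟨x, hx⟩)).image
        fun w : (Γᶜ : Set (Site d)) => l1dist x (w : Site d)).bddAbove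
      exact ⟨n, fun _ w hw => hn ⟨w, SimpleGraph.ConnectedComponent.sound hw.symm, rfl⟩⟩
    · exact ⟨0, fun hx' => absurd hx' hx⟩
  choose n hn using hfin
  refine ⟨Finset.univ.sup fun q : Site d ⧸ 𝒢 => n q.out, fun x w hxw => ?_⟩
  obtain ⟨a, ha⟩ := QuotientAddGroup.mk_out_eq_add 𝒢 (x : Site d)
  have hshift : ∀ y : (Γᶜ : Set (Site d)), (y : Site d) + a ∈ Γᶜ := fun y hy =>
    y.2 ((h a a.2 y).1.1 hy)
  let f : (latticeGraph d).induce Γᶜ →g (latticeGraph d).induce Γᶜ :=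
    { toFun := fun y => ⟨y + a, hshift y⟩
      map_rel' := fun {y y'} hy => by
        change l1dist ((y : Site d) + (a : Site d)) ((y' : Site d) + (a : Site d)) = 1
        rw [l1dist_add_right]
        exact hy }
  have hle := hn ((x : Site d) + a) (hshift x) (f w) (hxw.map f)
  rw [show ((f w : (Γᶜ : Set (Site d))) : Site d) = w + a from rfl, l1dist_add_right, ← ha] at hle
  exact hle.trans (Finset.le_sup (f := fun q : Site d ⧸ 𝒢 => n q.out) (Finset.mem_univ _))

open Classical in
/-- The clusters: each component of `Γᶜ` together with the sites of `Γ` adjacent to it, and the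
remaining sites of `Γ` one by one. Double insulation makes the former pairwise disjoint. -/
lemma IsDoublyInsulated.exists_isClusterMap (hΓ : IsDoublyInsulated Γ)
    (hinv : IsCofinitelyInvariant Γ V₀) :
    ∃ (T : Type) (κ : Site d → T) (R : ℕ), IsClusterMap Γ κ R := by
  obtain ⟨D, hD⟩ := hinv.exists_l1dist_le hΓ
  set 𝒞 := (latticeGraph d).induce Γᶜ with h𝒞
  let κ : Site d → Site d ⊕ 𝒞.ConnectedComponent := fun x =>
    if hx : x ∈ Γᶜ then Sum.inr (𝒞.connectedComponentMk ⟨x, hx⟩)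
    else if h : ∃ w : (Γᶜ : Set (Site d)), l1dist x w = 1
      then Sum.inr (𝒞.connectedComponentMk h.choose) else Sum.inl x
  have hκ1 : ∀ w : (Γᶜ : Set (Site d)), κ w = Sum.inr (𝒞.connectedComponentMk w) := fun w =>
    dif_pos w.2
  have hκ2 : ∀ x ∈ Γ, ∀ w : (Γᶜ : Set (Site d)), l1dist x w = 1 →
      κ x = Sum.inr (𝒞.connectedComponentMk w) := by
    intro x hx w hw
    have hex : ∃ w : (Γᶜ : Set (Site d)), l1dist x w = 1 := ⟨w, hw⟩
    simp only [κ]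
    rw [dif_neg (fun h => h hx), dif_pos hex]
    congr 1
    by_contra hne
    have h1 := hΓ.2 _ _ hne hex.choose SimpleGraph.ConnectedComponent.connectedComponentMk_mem w
      SimpleGraph.ConnectedComponent.connectedComponentMk_mem
    have h2 := hex.choose_spec
    have h3 := l1dist_triangle (hex.choose : Site d) x w
    rw [l1dist_comm _ x] at h3
    omega
  have hκ3 : ∀ x, κ x = Sum.inl x ∨ ∃ w : (Γᶜ : Set (Site d)),
      κ x = Sum.inr (𝒞.connectedComponentMk w) ∧ l1dist x w ≤ 1 := by
    intro x
    by_cases hx : x ∈ Γᶜ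
    · exact Or.inr ⟨⟨x, hx⟩, hκ1 ⟨x, hx⟩, by rw [l1dist_self]; omega⟩
    by_cases h : ∃ w : (Γᶜ : Set (Site d)), l1dist x w = 1
    · obtain ⟨w, hw⟩ := h
      exact Or.inr ⟨w, hκ2 x (not_not.1 hx) w hw, hw.le⟩
    · left
      simp only [κ]
      rw [dif_neg hx, dif_neg h]
  refine ⟨_, κ, D + 2, ⟨fun x w hxw hne => ?_, fun x w hxw => ?_⟩⟩
  · by_contra hx
    refine hne ?_
    rw [hκ1 ⟨x, hx⟩]
    by_cases hw : w ∈ Γ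
    · exact (hκ2 w hw ⟨x, hx⟩ (by rw [l1dist_comm]; exact hxw)).symm
    · rw [hκ1 ⟨w, hw⟩]
      congr 1
      refine SimpleGraph.ConnectedComponent.sound (SimpleGraph.Adj.reachable ?_)
      exact hxw
  · rcases hκ3 x with hx | ⟨a, hx, hxa⟩ <;> rcases hκ3 w with hw | ⟨b, hw, hwb⟩ <;>
      rw [hx, hw] at hxw
    · rw [Sum.inl_injective hxw, l1dist_self]
      omega
    · exact absurd hxw (by simp)
    · exact absurd hxw (by simp)
    · have h1 := hD a b (SimpleGraph.ConnectedComponent.exact (Sum.inr_injective hxw))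
      have h2 := l1dist_triangle x a w
      have h3 := l1dist_triangle (a : Site d) b w
      rw [l1dist_comm (b : Site d) w] at h3
      omega

open Classical in
lemma IsClusterMap.exists_tendsto_atTop {T : Type*} {κ : Site d → T} {R : ℕ}
    (hκ : IsClusterMap Γ κ R) : ∃ Λ : ℕ → Finset (Site d),
      Filter.Tendsto Λ Filter.atTop Filter.atTop ∧ ∀ n, IsClusterUnion κ (Λ n) := by
  refine ⟨fun n => (cube n 0).biUnion fun w => (cube R w).filter fun x => κ x = κ w,
    Filter.tendsto_atTop_finset_of_monotone (fun m n hmn => ?_) (fun x => ⟨l1dist 0 x, ?_⟩),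
    fun n x hx x' hx' => ?_⟩
  · refine Finset.biUnion_subset_biUnion_of_subset_left _ (Fintype.piFinset_subset _ _ fun i => ?_)
    exact Finset.Icc_subset_Icc (by omega) (by omega)
  · exact Finset.mem_biUnion.2 ⟨x, mem_cube_of_l1dist_le le_rfl, Finset.mem_filter.2
      ⟨mem_cube_of_l1dist_le (by rw [l1dist_self]; omega), rfl⟩⟩
  · obtain ⟨w, hw, hxw⟩ := Finset.mem_biUnion.1 hx
    have h1 := (Finset.mem_filter.1 hxw).2
    exact Finset.mem_biUnion.2 ⟨w, hw, Finset.mem_filter.2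
      ⟨mem_cube_of_l1dist_le (hκ.dist_le w x' (hx'.trans h1).symm), hx'.trans h1⟩⟩

end Clusters

/-! ### Exponential sums over the lattice -/

lemma tsum_pi_prod_eq_pow {α : Type*} (f : α → ℝ≥0∞) (d : ℕ) :
    ∑' y : Fin d → α, ∏ i, f (y i) = (∑' a, f a) ^ d := by
  induction d with
  | zero => simp
  | succ d ih =>
    rw [← (Fin.consEquiv fun _ => α).tsum_eq, ENNReal.tsum_prod', pow_succ', ← ih,
      ← ENNReal.tsum_mul_right]
    refine tsum_congr fun a => ?_
    rw [← ENNReal.tsum_mul_left]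
    refine tsum_congr fun y => ?_
    simp [Fin.consEquiv, Fin.prod_univ_succ]

lemma exists_tsum_exp_neg_mul_l1dist_le {c : ℝ} (hc : 0 < c) (d : ℕ) :
    ∃ S : ℝ≥0∞, S ≠ ∞ ∧ ∀ x : Site d,
      ∑' y : Site d, ENNReal.ofReal (Real.exp (-(c * l1dist x y))) ≤ S := by
  refine ⟨(∑' a : ℤ, ENNReal.ofReal (Real.exp (-(c * a.natAbs)))) ^ d, ?_, fun x => ?_⟩
  · refine ENNReal.pow_ne_top (Summable.tsum_ofReal_ne_top ?_)
    have h : Summable fun n : ℕ => Real.exp (-(c * n)) := by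
      have := Real.summable_exp_nat_mul_iff.2 (neg_lt_zero.2 hc)
      refine this.congr fun n => ?_
      ring_nf
    refine Summable.of_nat_of_neg ?_ ?_ <;> simpa using h
  · rw [← tsum_pi_prod_eq_pow, ← (Equiv.subLeft x).tsum_eq]
    refine (tsum_congr fun y => ?_).le
    rw [← ENNReal.ofReal_prod_of_nonneg fun _ _ => (Real.exp_pos _).le, ← Real.exp_sum]
    simp [l1dist, Finset.mul_sum]

/-! ### The fractional moment bound -/

section Assembly

variable {Ω : Type*} [MeasurableSpace Ω] {P : Measure Ω} {d : ℕ} {Γ : Set (Site d)}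
  {V₀ : Site d → ℝ} {μ : Measure ℝ} {V : Ω → Site d → ℝ} {g : ℝ}

lemma IsTrimmedRandomPotential.measurable_trimmedPotential
    (hV : IsTrimmedRandomPotential P Γ μ V) (V₀ : Site d → ℝ) (g : ℝ) :
    Measurable (trimmedPotential V₀ V g) :=
  measurable_pi_lambda _ fun x => ((hV.measurable_apply x).const_mul g).const_add (V₀ x)

lemma exists_lintegral_enorm_rpow_le_of_integrable [IsProbabilityMeasure μ] {q : ℝ}
    (hq : Integrable (fun t : ℝ => |t| ^ q) μ) :
    ∃ m : ℝ≥0∞, m ≠ ∞ ∧ ∀ t', 0 < t' → t' ≤ q → ∫⁻ t, ‖t‖ₑ ^ t' ∂μ ≤ m := by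
  refine ⟨1 + ∫⁻ t, ‖|t| ^ q‖ₑ ∂μ, ENNReal.add_ne_top.2
    ⟨ENNReal.one_ne_top, hq.hasFiniteIntegral.ne⟩, fun t' ht' htq => ?_⟩
  have hpt : ∀ t : ℝ, ‖t‖ₑ ^ t' ≤ 1 + ‖|t| ^ q‖ₑ := by
    intro t
    have h2 : ‖|t| ^ q‖ₑ = ‖t‖ₑ ^ q := by
      rw [← ofReal_norm, ← ofReal_norm, Real.norm_of_nonneg (by positivity), Real.norm_eq_abs,
        ENNReal.ofReal_rpow_of_nonneg (abs_nonneg t) (ht'.le.trans htq)]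
    rw [h2]
    rcases le_total ‖t‖ₑ 1 with h | h
    · exact le_add_right (ENNReal.rpow_le_one h ht'.le)
    · exact le_add_left (ENNReal.rpow_le_rpow_of_exponent_le h htq)
  refine (lintegral_mono hpt).trans ?_
  rw [lintegral_add_left measurable_const, lintegral_const, measure_univ, mul_one]

lemma IsTrimmedRandomPotential.exists_moment_le [IsProbabilityMeasure P]
    (hV : IsTrimmedRandomPotential P Γ μ V) {v : ℝ} (hv : ∀ x, |V₀ x| ≤ v) {m : ℝ≥0∞}
    (hm : m ≠ ∞) {t : ℝ} (ht : 0 < t) (ht1 : t ≤ 1)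
    (hmt : ∫⁻ a, ‖a‖ₑ ^ t ∂μ ≤ m) (g Z : ℝ) :
    ∃ M : ℝ≥0∞, M ≠ ∞ ∧ ∀ z : ℂ, ‖z‖ ≤ Z → ∀ x,
      ∫⁻ ω, ‖(2 * d : ℂ) + trimmedPotential V₀ V g ω x - z‖ₑ ^ t ∂P ≤ M := by
  refine ⟨ENNReal.ofReal (2 * d + v + Z) ^ t + ‖g‖ₑ ^ t * m, ?_, fun z hz x => ?_⟩
  · exact ENNReal.add_ne_top.2 ⟨ENNReal.rpow_ne_top_of_nonneg ht.le ENNReal.ofReal_ne_top,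
      ENNReal.mul_ne_top (ENNReal.rpow_ne_top_of_nonneg ht.le enorm_ne_top) hm⟩
  have hpt : ∀ ω, ‖(2 * d : ℂ) + trimmedPotential V₀ V g ω x - z‖ₑ ^ t
      ≤ ENNReal.ofReal (2 * d + v + Z) ^ t + ‖g‖ₑ ^ t * ‖V ω x‖ₑ ^ t := by
    intro ω
    rw [← ENNReal.mul_rpow_of_nonneg _ _ ht.le]
    refine le_trans (ENNReal.rpow_le_rpow ?_ ht.le) (ENNReal.rpow_add_le_add_rpow _ _ ht.le ht1)
    have h1 : (2 * d : ℂ) + trimmedPotential V₀ V g ω x - z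
        = ((2 * d : ℂ) + (V₀ x : ℂ) - z) + ((g * V ω x : ℝ) : ℂ) := by
      simp only [trimmedPotential]
      push_cast
      ring
    rw [h1]
    refine (enorm_add_le _ _).trans (add_le_add ?_ (le_of_eq ?_))
    · rw [← ofReal_norm]
      refine ENNReal.ofReal_le_ofReal ((norm_sub_le _ _).trans (add_le_add
        ((norm_add_le _ _).trans (add_le_add ?_ ?_)) hz))
      · simp
      · simpa using hv x
    · rw [← enorm_mul, ← ofReal_norm, ← ofReal_norm, Complex.norm_real]
  refine (lintegral_mono hpt).trans ?_
  have hVx : Measurable fun ω => ‖V ω x‖ₑ ^ t := by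
    have := hV.measurable_apply x
    fun_prop
  rw [lintegral_add_left measurable_const, lintegral_const, measure_univ, mul_one,
    lintegral_const_mul _ hVx]
  gcongr
  by_cases hx : x ∈ Γ
  · rw [← hV.law x hx, lintegral_map (f := fun a : ℝ => ‖a‖ₑ ^ t) (by fun_prop)
      (hV.measurable x hx)] at hmt
    exact hmt
  · simp [hV.eq_zero _ x hx, ENNReal.zero_rpow_of_pos ht]

open Classical in
/-- The decay on `Γ` as a bound for expectations, with the number of crossed clusters replaced by
the distance divided by `R + 1`. -/
lemma IsTrimmedRandomPotential.hasBoxDecay [IsProbabilityMeasure P] [IsProbabilityMeasure μ]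
    (hV : IsTrimmedRandomPotential P Γ μ V)
    {T : Type*} {κ : Site d → T} {R : ℕ} (hκ : IsClusterMap Γ κ R) {s : ℝ} (hs : 0 < s)
    (hs1 : s ≤ 1) {c : ℝ≥0∞} (hcf : c ≠ ∞) (hc : ∀ τ : ℝ, ∫⁻ t, ‖t - τ‖ₑ⁻¹ ^ s ∂μ ≤ c)
    (hg : 0 < g) (hsmall : ((2 * R + 1) ^ d * (2 * d) : ℝ≥0∞)
      * ((2 ^ s + 2 ^ s + 1) * ((ENNReal.ofReal g)⁻¹ ^ s * c)) ≤ 2⁻¹) (Z : ℝ) :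
    HasBoxDecay P (trimmedPotential V₀ V g) κ Z Γ Γ s (Real.log 2 / (R + 1)) := by
  refine ⟨(2 ^ s + 2 ^ s + 1) * ((ENNReal.ofReal g)⁻¹ ^ s * c) * 2, ?_,
    fun Λ hΛ z hz _ x hx hxΓ y hy hyΓ => ?_⟩
  · have h2 : (2 : ℝ≥0∞) ^ s ≠ ∞ := ENNReal.rpow_ne_top_of_nonneg hs.le (by norm_num)
    have hgi : (ENNReal.ofReal g)⁻¹ ≠ ∞ := by simpa using hg
    refine ENNReal.mul_ne_top (ENNReal.mul_ne_top (ENNReal.add_ne_top.2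
      ⟨ENNReal.add_ne_top.2 ⟨h2, h2⟩, ENNReal.one_ne_top⟩) (ENNReal.mul_ne_top
      (ENNReal.rpow_ne_top_of_nonneg hs.le hgi) hcf)) (by norm_num)
  have hνμ : ∀ x ∈ Γ, siteLaw Γ μ x = μ := fun x hx => if_pos hx
  have h := lmarginal_boxGreen_le_half_pow (V₀ := V₀) hκ hνμ hs hs1 hc hg hsmall hz
    (l1dist x y / (R + 1)) Λ hΛ x hx y hy hxΓ hyΓ (Nat.mul_div_le _ _) 0
  rw [← hV.lintegral_eq_lmarginal Λ (measurable_enorm_boxGreen_rpow V₀ g z Λ x y s)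
    (fun v w hvw => by rw [boxGreen_congr z fun i hi => by rw [hvw i hi]])] at h
  refine h.trans ?_
  rw [mul_assoc _ (2 : ℝ≥0∞)]
  refine mul_le_mul' le_rfl ?_
  have h2 : (2⁻¹ : ℝ≥0∞) = ENNReal.ofReal (2⁻¹ : ℝ) := by
    rw [ENNReal.ofReal_inv_of_pos two_pos]; simp
  rw [h2, ← ENNReal.ofReal_pow (by norm_num), show (2 : ℝ≥0∞) = ENNReal.ofReal 2 by simp,
    ← ENNReal.ofReal_mul zero_le_two]
  refine ENNReal.ofReal_le_ofReal ?_
  have e1 : ((2 : ℝ)⁻¹) ^ (l1dist x y / (R + 1))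
      = Real.exp (-(Real.log 2 * ((l1dist x y / (R + 1) : ℕ) : ℝ))) := by
    rw [← neg_mul, mul_comm, Real.exp_nat_mul, Real.exp_neg, Real.exp_log two_pos]
  have e2 : (2 : ℝ) = Real.exp (Real.log 2) := (Real.exp_log two_pos).symm
  rw [e1]
  nth_rewrite 2 [e2]
  rw [← Real.exp_add, Real.exp_le_exp]
  have hl : (l1dist x y : ℝ) ≤ (R + 1) * (((l1dist x y / (R + 1) : ℕ) : ℝ) + 1) := by
    have := (Nat.lt_mul_div_succ (l1dist x y) (Nat.succ_pos R)).le
    exact_mod_cast this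
  have hlog : 0 < Real.log 2 := Real.log_pos one_lt_two
  have hR : (0 : ℝ) < R + 1 := by positivity
  have : Real.log 2 / (R + 1) * l1dist x y
      ≤ Real.log 2 * (((l1dist x y / (R + 1) : ℕ) : ℝ) + 1) := by
    rw [div_mul_eq_mul_div, div_le_iff₀ hR]
    nlinarith
  linarith

/-- Fatou's lemma transfers bounds that are uniform in the box to the infinite volume. -/
lemma lintegral_green_rpow_le {U : Ω → Site d → ℝ} (hU : Measurable U) {T : Type*}
    {κ : Site d → T} {R : ℕ} (hκ : IsClusterMap Γ κ R) {z : ℂ} (hz : 0 < z.im) {s : ℝ}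
    (hs : 0 < s) {x y : Site d} {K : ℝ≥0∞}
    (hK : ∀ Λ, IsClusterUnion κ Λ → x ∈ Λ → y ∈ Λ →
      ∫⁻ ω, ‖boxGreen (U ω) z Λ x y‖ₑ ^ s ∂P ≤ K) :
    ∫⁻ ω, ‖green (U ω) z x y‖ₑ ^ s ∂P ≤ K := by
  obtain ⟨Λ, hΛ, hΛκ⟩ := hκ.exists_tendsto_atTop
  have hlim : ∀ ω, Filter.Tendsto (fun n => ‖boxGreen (U ω) z (Λ n) x y‖ₑ ^ s) Filter.atTop
      (nhds (‖green (U ω) z x y‖ₑ ^ s)) := fun ω =>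
    (ENNReal.continuous_rpow_const.tendsto _).comp
      (((tendsto_boxGreen hz x y).comp hΛ).enorm)
  have hm : ∀ n, Measurable fun ω => ‖boxGreen (U ω) z (Λ n) x y‖ₑ ^ s := fun n =>
    ((measurable_boxGreen z (Λ n) x y).comp hU).enorm.pow_const s
  calc ∫⁻ ω, ‖green (U ω) z x y‖ₑ ^ s ∂P
      = ∫⁻ ω, Filter.liminf (fun n => ‖boxGreen (U ω) z (Λ n) x y‖ₑ ^ s) Filter.atTop ∂P :=
        lintegral_congr fun ω => (hlim ω).liminf_eq.symm
    _ ≤ Filter.liminf (fun n => ∫⁻ ω, ‖boxGreen (U ω) z (Λ n) x y‖ₑ ^ s ∂P) Filter.atTop :=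
        lintegral_liminf_le hm
    _ ≤ Filter.liminf (fun _ => K) Filter.atTop := by
        refine Filter.liminf_le_liminf (Filter.Eventually.of_forall fun n => ?_)
        by_cases hmem : x ∈ Λ n ∧ y ∈ Λ n
        · exact hK _ (hΛκ n) hmem.1 hmem.2
        · simp [boxGreen, hmem, ENNReal.zero_rpow_of_pos hs]
    _ = K := Filter.liminf_const K

/-- Uniform exponential decay in boxes, for `‖z‖` up to `|lam| + 4 d`, gives the fractional moment
bound at energy `lam`; larger imaginary parts of `z` are harmless for every potential. -/
lemma HasBoxDecay.fractionalMomentBound [IsProbabilityMeasure P] {U : Ω → Site d → ℝ}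
    (hU : Measurable U) (hd : 1 ≤ d)
    {T : Type*} {κ : Site d → T} {R : ℕ} (hκ : IsClusterMap Γ κ R) {s η' η lam : ℝ} (hs : 0 < s)
    (hη : η < η') (hηs : η' ≤ s * Real.log 2)
    (h : HasBoxDecay P U κ (|lam| + 4 * d) Set.univ Set.univ s η') :
    FractionalMomentBound P U s η lam := by
  obtain ⟨C, hC, h⟩ := h
  have hbound : ∀ (ε : ℝ), 0 < ε → ∀ x y : Site d,
      ∫⁻ ω, ‖green (U ω) (lam + ε * Complex.I) x y‖ₑ ^ s ∂P
        ≤ (C + 1) * ENNReal.ofReal (Real.exp (-(η' * l1dist x y))) := by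
    intro ε hε x y
    have him : ((lam : ℂ) + ε * Complex.I).im = ε := by simp
    refine lintegral_green_rpow_le hU hκ (by rw [him]; exact hε) hs fun Λ hΛ hx hy => ?_
    rcases le_total ε (4 * d) with hεd | hεd
    · refine (h Λ hΛ _ (by rw [him]; exact hε) ?_ x hx trivial y hy trivial).trans
        (mul_le_mul_left le_self_add _)
      refine (norm_add_le _ _).trans (add_le_add (by simp) ?_)
      simpa [abs_of_pos hε] using hεd
    · refine le_trans ?_ (mul_le_mul_left le_add_self _)
      rw [one_mul]
      have hpt : ∀ ω, ‖boxGreen (U ω) (lam + ε * Complex.I) Λ x y‖ₑ ^ s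
          ≤ ENNReal.ofReal (Real.exp (-(η' * l1dist x y))) := by
        intro ω
        refine (ENNReal.rpow_le_rpow (enorm_boxGreen_le_half_pow hd (by rw [him]; exact hεd)
          (l1dist x y) Λ x y le_rfl) hs.le).trans ?_
        have h2 : (2⁻¹ : ℝ≥0∞) = ENNReal.ofReal (Real.exp (-Real.log 2)) := by
          rw [Real.exp_neg, Real.exp_log two_pos, ENNReal.ofReal_inv_of_pos two_pos]; simp
        rw [h2, ← ENNReal.ofReal_pow (Real.exp_pos _).le, ← Real.exp_nat_mul,
          ENNReal.ofReal_rpow_of_pos (Real.exp_pos _), ← Real.exp_mul]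
        refine ENNReal.ofReal_le_ofReal (Real.exp_le_exp.2 ?_)
        nlinarith [Nat.cast_nonneg (α := ℝ) (l1dist x y)]
      simpa using lintegral_mono (μ := P) hpt
  obtain ⟨S, hS, hsum⟩ := exists_tsum_exp_neg_mul_l1dist_le (sub_pos.2 hη) d
  refine lt_of_le_of_lt (iSup_le fun ε => iSup_le fun hε => iSup_le fun x => ?_)
    (ENNReal.mul_lt_top (ENNReal.add_lt_top.2 ⟨hC.lt_top, ENNReal.one_lt_top⟩) hS.lt_top)
  refine le_trans ?_ (mul_le_mul_right (hsum x) (C + 1))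
  rw [← ENNReal.tsum_mul_left]
  refine ENNReal.tsum_le_tsum fun y => ?_
  have hconv : ∀ w : ℂ, ENNReal.ofReal (‖w‖ ^ s) = ‖w‖ₑ ^ s := fun w => by
    rw [← ENNReal.ofReal_rpow_of_nonneg (norm_nonneg w) hs.le, ofReal_norm]
  simp only [hconv]
  refine (mul_le_mul_left (hbound ε hε x y) _).trans (le_of_eq ?_)
  rw [mul_assoc, ← ENNReal.ofReal_mul (Real.exp_pos _).le, ← Real.exp_add]
  ring_nf

end Assembly

lemma HasBoxDecay.mono_rate {Ω : Type*} [MeasurableSpace Ω] {P : Measure Ω} {d : ℕ} {T : Type*}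
    {U : Ω → Site d → ℝ} {κ : Site d → T} {Z : ℝ} {A B : Set (Site d)} {t η η' : ℝ} (hη : η' ≤ η)
    (h : HasBoxDecay P U κ Z A B t η) : HasBoxDecay P U κ Z A B t η' := by
  obtain ⟨C, hC, h⟩ := h
  refine ⟨C, hC, fun Λ hΛ z hz hzZ x hx hxA y hy hyB =>
    (h Λ hΛ z hz hzZ x hx hxA y hy hyB).trans ?_⟩
  gcongr

lemma exists_forall_le_mul_inv_rpow_le {s : ℝ} (hs : 0 < s) {N : ℝ≥0∞} (hN : N ≠ ∞) :
    ∃ g₀ : ℝ, 0 < g₀ ∧ ∀ g, g₀ ≤ g → N * (ENNReal.ofReal g)⁻¹ ^ s ≤ 2⁻¹ := by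
  have h1 : Filter.Tendsto (fun g : ℝ => N * (ENNReal.ofReal g)⁻¹ ^ s) Filter.atTop
      (nhds (N * 0)) := by
    refine ENNReal.Tendsto.const_mul ?_ (Or.inr hN)
    have h2 : Filter.Tendsto (fun g : ℝ => (ENNReal.ofReal g)⁻¹) Filter.atTop (nhds 0) :=
      by simpa using tendsto_inv_iff.2 ENNReal.tendsto_ofReal_atTop
    have h3 := (ENNReal.continuous_rpow_const (y := s)).tendsto 0
    rw [ENNReal.zero_rpow_of_pos hs] at h3
    exact h3.comp h2
  rw [mul_zero] at h1
  obtain ⟨g₁, hg₁⟩ := Filter.eventually_atTop.1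
    (h1.eventually_le_const (u := (2⁻¹ : ℝ≥0∞)) (ENNReal.inv_pos.2 (by norm_num)))
  exact ⟨max g₁ 1, by positivity, fun g hg => hg₁ g ((le_max_left _ _).trans hg)⟩

theorem mainTheorem3 {d : ℕ} (hd : 1 ≤ d)
    (Γ : Set (Site d)) (V₀ : Site d → ℝ) (hinv : IsCofinitelyInvariant Γ V₀)
    (μ : Measure ℝ) [IsProbabilityMeasure μ] (hreg : IsAlphaRegular μ) (hmom : HasFiniteMoment μ)
    {Ω : Type*} [MeasurableSpace Ω] (P : Measure Ω) [IsProbabilityMeasure P]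
    (V : Ω → Site d → ℝ) (hV : IsTrimmedRandomPotential P Γ μ V)
    (hΓ : IsDoublyInsulated Γ) :
    ∃ s η g₀ : ℝ, 0 < s ∧ s < 1 ∧ 0 < η ∧ 0 < g₀ ∧
      ∀ g : ℝ, g₀ ≤ g → ∀ lam : ℝ,
        FractionalMomentBound P (trimmedPotential V₀ V g) s η lam := by
  obtain ⟨α, hα, C, hC⟩ := hreg
  obtain ⟨q, hq, hqint⟩ := hmom
  obtain ⟨T, κ, R, hκ⟩ := hΓ.exists_isClusterMap hinv
  obtain ⟨v, hv⟩ := hinv.exists_forall_abs_le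
  obtain ⟨m, hm, hmq⟩ := exists_lintegral_enorm_rpow_le_of_integrable hqint
  -- The exponent on `Γ`: at most `1` for subadditivity, less than `α` for the a priori bound, and
  -- at most `q` for the moments of the potential.
  set t : ℝ := min 1 (min (α / 2) q) with ht
  have ht0 : 0 < t := lt_min one_pos (lt_min (by positivity) hq)
  have ht1 : t ≤ 1 := min_le_left _ _
  have htα : t < α := ((min_le_right _ _).trans (min_le_left _ _)).trans_lt (by linarith)
  have htq : t ≤ q := (min_le_right _ _).trans (min_le_right _ _)
  obtain ⟨c, hcf, hc⟩ := exists_lintegral_inv_enorm_sub_rpow_le hC ht0 htα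
  have h2t : (2 : ℝ≥0∞) ^ t ≠ ∞ := ENNReal.rpow_ne_top_of_nonneg ht0.le (by norm_num)
  obtain ⟨g₀, hg₀, hsmall⟩ := exists_forall_le_mul_inv_rpow_le ht0
    (N := ((2 * R + 1) ^ d * (2 * d) : ℝ≥0∞) * ((2 ^ t + 2 ^ t + 1) * c)) (by
      refine ENNReal.mul_ne_top (ENNReal.mul_ne_top (ENNReal.pow_ne_top (by finiteness))
        (by finiteness)) (ENNReal.mul_ne_top ?_ hcf)
      exact ENNReal.add_ne_top.2 ⟨ENNReal.add_ne_top.2 ⟨h2t, h2t⟩, ENNReal.one_ne_top⟩)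
  -- Each of the two propagations, in `x` and in `y`, divides exponent and rate by `2 ^ (R + 1)`.
  set s : ℝ := t / 2 ^ (R + 1) / 2 ^ (R + 1) with hs
  set η₁ : ℝ := Real.log 2 / (R + 1) / 2 ^ (R + 1) / 2 ^ (R + 1) with hη₁
  have hlog : 0 < Real.log 2 := Real.log_pos one_lt_two
  have hs0 : 0 < s := by positivity
  have hη₁0 : 0 < η₁ := by positivity
  have hpow : (1 : ℝ) < 2 ^ (R + 1) := one_lt_pow₀ one_lt_two (Nat.succ_ne_zero R)
  have htR : t / 2 ^ (R + 1) ≤ t := div_le_self ht0.le hpow.le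
  have hs1 : s < 1 := (div_lt_self (by positivity) hpow).trans_le (htR.trans ht1)
  have hη' : 0 < min η₁ (s * Real.log 2) := lt_min hη₁0 (by positivity)
  refine ⟨s, min η₁ (s * Real.log 2) / 2, g₀, hs0, hs1, by positivity, hg₀, fun g hg lam => ?_⟩
  have hU := hV.measurable_trimmedPotential V₀ g
  have hdecay := hV.hasBoxDecay (V₀ := V₀) (g := g) hκ ht0 ht1 hcf hc (hg₀.trans_le hg)
    (le_of_eq_of_le (by ring) (hsmall g hg)) (|lam| + 4 * d)
  have hmoment : ∀ t' : ℝ, 0 < t' → t' ≤ t → ∃ M : ℝ≥0∞, M ≠ ∞ ∧ ∀ z : ℂ,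
      ‖z‖ ≤ |lam| + 4 * d → ∀ x,
      ∫⁻ ω, ‖(2 * d : ℂ) + trimmedPotential V₀ V g ω x - z‖ₑ ^ t' ∂P ≤ M := fun t' ht' htt =>
    hV.exists_moment_le hv hm ht' (htt.trans ht1) (hmq t' ht' (htt.trans htq)) g _
  have hx := hdecay.propagate hU hκ hd ht0 ht1 (by positivity) hmoment
  have hxy := hx.symm.propagate hU hκ hd (by positivity) (htR.trans ht1) (by positivity)
    fun t' ht' htt => hmoment t' ht' (htt.trans htR)
  exact (hxy.mono_rate (min_le_left _ _)).fractionalMomentBound hU hd hκ hs0 (half_lt_self hη')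
    (min_le_right _ _)
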